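/- Let $p$ be a prime and let $k$ be an arbitrary field of characteristic $p$. Let $Y$ be a smooth proper integral curve over $k$, let $y \in Y(k)$ be a $k$-rational point, and put $Y' = Y \setminus \{y\}$. Choose an isomorphism of $k$-algebras $\widehat{\mathcal{O}_{Y,y}} \cong k[[t]]$. It induces a morphism $\operatorname{Spec} k((t)) \to Y'$ (the inclusion of the formal punctured neighbourhood of $y$) and a ring homomorphism $\mathcal{O}(Y') \hookrightarrow k((t))$ through which we regard $\mathcal{O}(Y')$ as a subring of $k((t))$. For a scheme $S$ and a (not necessarily abelian) group $\Gamma$ let $H^1(S,\Gamma) = \check{H}^1_{\mathrm{et}}(S, \underline{\Gamma})$ be the Čech cohomology set of the constant sheaf of groups $\underline{\Gamma}$ in the étale topology of $S$, which classifies principal $\Gamma$-bundles on $S$ up to isomorphism, and let $$\Psi_{Y,y,\Gamma} \colon H^1(Y',\Gamma) \to H^1(\operatorname{Spec} k((t)),\Gamma)$$ be the map given by pullback along $\operatorname{Spec} k((t)) \to Y'$. For a ring $R$ of characteristic $p$ let $\wp \colon R \to R$, $\wp(f) = f^p - f$, be the Artin--Schreier map. Let $G$ be a nontrivial finite $p$-group.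 Then the following are equivalent: (i) The equality $\wp(k((t))) \cap \mathcal{O}(Y') = \wp(\mathcal{O}(Y'))$ holds in $k((t))$. (ii) The map $\Psi_{Y,y,G}$ is injective. (iii) The map $\Psi_{Y,y,\mathbb{Z}/p\mathbb{Z}}$ is injective. -/

import Mathlib

open CategoryTheory CategoryTheory.Limits AlgebraicGeometry
open CategoryTheory.PresheafOfGroups
open scoped PowerSeries LaurentSeries

universe w u

namespace LocalGlobal

noncomputable section

/-! ### Čech cohomology of constant sheaves of groups in the étale topology -/

/-- The constant étale sheaf of groups attached to `G`: its sections over a scheme `T` are the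
locally constant functions `T → G`. -/
def constSheaf (G : Type w) [Group G] : Scheme.{u}ᵒᵖ ⥤ GrpCat.{max u w} where
  obj T := GrpCat.of (LocallyConstant T.unop G)
  map f := GrpCat.ofHom (LocallyConstant.comapMonoidHom f.unop.base.hom)
  map_id _ := rfl
  map_comp _ _ := rfl

/-- The constant sheaf attached to `G` on schemes over `S`. -/
abbrev constSheafOver (S : Scheme.{u}) (G : Type w) [Group G] : (Over S)ᵒᵖ ⥤ GrpCat.{max u w} :=
  (Over.forget S).op ⋙ constSheaf.{w, u} G

/-- Étale coverings of `S`: jointly surjective families of étale morphisms to `S`. -/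
structure EtaleCover (S : Scheme.{u}) where
  /-- The index set. -/
  I₀ : Type u
  /-- The members of the covering. -/
  X : I₀ → Scheme.{u}
  /-- The structure morphisms. -/
  f (i : I₀) : X i ⟶ S
  etale (i : I₀) : Etale (f i)
  exists_eq (x : S) : ∃ (i : I₀) (z : X i), f i z = x

/-- The base change of an étale covering. -/
abbrev pullbackCover {S' S : Scheme.{u}} (f : S' ⟶ S) (𝒰 : EtaleCover S) : EtaleCover S' where
  I₀ := 𝒰.I₀
  X i := pullback f (𝒰.f i)
  f i := pullback.fst f (𝒰.f i)
  etale i := by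
    have : Etale (𝒰.f i) := 𝒰.etale i
    infer_instance
  exists_eq x := by
    obtain ⟨i, z, hz⟩ := 𝒰.exists_eq (f x)
    obtain ⟨t, ht, -⟩ := Scheme.Pullback.exists_preimage_pullback x z hz.symm
    exact ⟨i, t, ht⟩

/-- The common refinement of two étale coverings of `S` by the fibre products of their members. -/
abbrev interCover {S : Scheme.{u}} (𝒰 𝒱 : EtaleCover S) : EtaleCover S where
  I₀ := 𝒰.I₀ × 𝒱.I₀
  X i := pullback (𝒰.f i.1) (𝒱.f i.2)
  f i := pullback.fst (𝒰.f i.1) (𝒱.f i.2) ≫ 𝒰.f i.1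
  etale i := by
    have : Etale (𝒰.f i.1) := 𝒰.etale i.1
    have : Etale (𝒱.f i.2) := 𝒱.etale i.2
    infer_instance
  exists_eq x := by
    obtain ⟨i, z, hz⟩ := 𝒰.exists_eq x
    obtain ⟨j, z', hz'⟩ := 𝒱.exists_eq x
    obtain ⟨t, ht, -⟩ := Scheme.Pullback.exists_preimage_pullback z z' (hz.trans hz'.symm)
    exact ⟨(i, j), t, by rw [Scheme.Hom.comp_apply, ht, hz]⟩

/-- Čech 1-cocycles with values in `G` on an étale covering `(U i → S)`. A section over
`U i ×[S] U j` is given, in the Yoneda manner, by its values on all pairs of `S`-morphisms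
`T ⟶ U i` and `T ⟶ U j`. -/
abbrev Cocycle {S : Scheme.{u}} (G : Type w) [Group G] (𝒰 : EtaleCover S) :=
  OneCocycle (constSheafOver S G) (fun i : 𝒰.I₀ ↦ Over.mk (𝒰.f i))

/-- A morphism from a covering of `S'` to a covering of `S` lying over `f : S' ⟶ S`. For `f = 𝟙 S`
it exhibits the first covering as a refinement of the second one. -/
structure CoverMap {S' S : Scheme.{u}} (f : S' ⟶ S) (𝒱 : EtaleCover S') (𝒰 : EtaleCover S) where
  /-- The map on index sets. -/
  idx : 𝒱.I₀ → 𝒰.I₀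
  /-- The morphisms between the members of the coverings. -/
  hom (i : 𝒱.I₀) : 𝒱.X i ⟶ 𝒰.X (idx i)
  comm (i : 𝒱.I₀) : hom i ≫ 𝒰.f (idx i) = 𝒱.f i ≫ f

namespace CoverMap

variable {S'' S' S : Scheme.{u}} {g : S'' ⟶ S'} {f : S' ⟶ S}
  {𝒲 : EtaleCover S''} {𝒱 : EtaleCover S'} {𝒰 𝒱₀ : EtaleCover S}

/-- An `S'`-morphism to a member of `𝒱`, seen as an `S`-morphism to a member of `𝒰`. -/
def push (m : CoverMap f 𝒱 𝒰) {i : 𝒱.I₀} {T : Over S'} (a : T ⟶ Over.mk (𝒱.f i)) :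
    (Over.map f).obj T ⟶ Over.mk (𝒰.f (m.idx i)) :=
  Over.homMk (a.left ≫ m.hom i) (by
    have h : a.left ≫ 𝒱.f i = T.hom := Over.w a
    simp [m.comm, ← h])

/-- The composition of morphisms of coverings. -/
def comp (n : CoverMap g 𝒲 𝒱) (m : CoverMap f 𝒱 𝒰) : CoverMap (g ≫ f) 𝒲 𝒰 where
  idx i := m.idx (n.idx i)
  hom i := n.hom i ≫ m.hom (n.idx i)
  comm i := by simp [m.comm, reassoc_of% n.comm]

/-- Replacing the base morphism by an equal one. -/
def cast {f' : S' ⟶ S} (m : CoverMap f 𝒱 𝒰) (h : f = f') : CoverMap f' 𝒱 𝒰 where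
  idx := m.idx
  hom := m.hom
  comm i := by rw [m.comm, h]

/-- The projection from the pulled back covering. -/
def ofPullback (f : S' ⟶ S) (𝒰 : EtaleCover S) : CoverMap f (pullbackCover f 𝒰) 𝒰 where
  idx i := i
  hom i := pullback.snd f (𝒰.f i)
  comm _ := pullback.condition.symm

variable {G : Type w} [Group G]

/-- The pullback of a Čech 1-cocycle along a morphism of coverings. -/
def pullbackCocycle (m : CoverMap f 𝒱 𝒰) (γ : Cocycle G 𝒰) : Cocycle G 𝒱 where
  ev i j _ a b := γ.ev (m.idx i) (m.idx j) (m.push a) (m.push b)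
  ev_precomp i j T T' φ a b := by
    have h := γ.ev_precomp (m.idx i) (m.idx j) ((Over.map f).map φ) (m.push a) (m.push b)
    have ha : (Over.map f).map φ ≫ m.push a = m.push (φ ≫ a) := by
      ext; simp [push]
    have hb : (Over.map f).map φ ≫ m.push b = m.push (φ ≫ b) := by
      ext; simp [push]
    rw [ha, hb] at h
    exact h
  ev_trans i j l T a b c := γ.ev_trans _ _ _ (m.push a) (m.push b) (m.push c)

lemma pullbackCocycle_cast {f' : S' ⟶ S} (m : CoverMap f 𝒱 𝒰) (h : f = f') (γ : Cocycle G 𝒰) :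
    (m.cast h).pullbackCocycle γ = m.pullbackCocycle γ := by
  subst h
  rfl

lemma isCohomologous_pullback (m : CoverMap f 𝒱 𝒰) {γ δ : Cocycle G 𝒰}
    (h : γ.IsCohomologous δ) :
    (m.pullbackCocycle γ).IsCohomologous (m.pullbackCocycle δ) := by
  obtain ⟨α, hα⟩ := h
  refine ⟨fun i ↦ (constSheaf.{w, u} G).map (m.hom i).op (α (m.idx i)), fun i j T a b ↦ ?_⟩
  exact hα (m.idx i) (m.idx j) (m.push a) (m.push b)

lemma isCohomologous_of_maps (m m' : CoverMap f 𝒱 𝒰) (γ : Cocycle G 𝒰) :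
    (m.pullbackCocycle γ).IsCohomologous (m'.pullbackCocycle γ) := by
  refine ⟨fun i ↦ γ.ev (m'.idx i) (m.idx i) (m'.push (𝟙 _)) (m.push (𝟙 _)), fun i j T a b ↦ ?_⟩
  have key : ∀ (l : 𝒱.I₀) (c : T ⟶ Over.mk (𝒱.f l)),
      (constSheafOver S' G).map c.op
        (γ.ev (m'.idx l) (m.idx l) (m'.push (𝟙 _)) (m.push (𝟙 _))) =
      γ.ev (m'.idx l) (m.idx l) (m'.push c) (m.push c) := by
    intro l c
    have h := γ.ev_precomp (m'.idx l) (m.idx l) ((Over.map f).map c)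
      (m'.push (𝟙 _)) (m.push (𝟙 _))
    have h₁ : (Over.map f).map c ≫ m'.push (𝟙 (Over.mk (𝒱.f l))) = m'.push c := by
      ext; simp [push]
    have h₂ : (Over.map f).map c ≫ m.push (𝟙 (Over.mk (𝒱.f l))) = m.push c := by
      ext; simp [push]
    rw [h₁, h₂] at h
    exact h
  rw [key i a, key j b]
  exact (γ.ev_trans _ _ _ (m'.push a) (m.push a) (m.push b)).trans
    (γ.ev_trans _ _ _ (m'.push a) (m'.push b) (m.push b)).symm

lemma pullbackCocycle_comp (n : CoverMap g 𝒲 𝒱) (m : CoverMap f 𝒱 𝒰) (γ : Cocycle G 𝒰) :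
    (n.comp m).pullbackCocycle γ = n.pullbackCocycle (m.pullbackCocycle γ) := by
  have key : ((n.comp m).pullbackCocycle γ).toOneCochain =
      (n.pullbackCocycle (m.pullbackCocycle γ)).toOneCochain := by
    refine OneCochain.ext ?_
    funext i j T a b
    let φ : (Over.map (g ≫ f)).obj T ⟶ (Over.map f).obj ((Over.map g).obj T) :=
      Over.homMk (𝟙 T.left) (by simp)
    have h := γ.ev_precomp (m.idx (n.idx i)) (m.idx (n.idx j)) φ
      (m.push (n.push a)) (m.push (n.push b))
    have ha : φ ≫ m.push (n.push a) = (n.comp m).push a := by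
      ext; simp [push, φ, comp]
    have hb : φ ≫ m.push (n.push b) = (n.comp m).push b := by
      ext; simp [push, φ, comp]
    rw [ha, hb] at h
    refine h.symm.trans ?_
    rfl
  cases h₁ : (n.comp m).pullbackCocycle γ
  cases h₂ : n.pullbackCocycle (m.pullbackCocycle γ)
  rw [h₁, h₂] at key
  cases key
  rfl

/-- The projection from the common refinement to the first covering. -/
def interFst (𝒰 𝒱 : EtaleCover S) : CoverMap (𝟙 S) (interCover 𝒰 𝒱) 𝒰 where
  idx i := i.1
  hom i := pullback.fst (𝒰.f i.1) (𝒱.f i.2)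
  comm _ := (Category.comp_id _).symm

/-- The projection from the common refinement to the second covering. -/
def interSnd (𝒰 𝒱 : EtaleCover S) : CoverMap (𝟙 S) (interCover 𝒰 𝒱) 𝒱 where
  idx i := i.2
  hom i := pullback.snd (𝒰.f i.1) (𝒱.f i.2)
  comm _ := pullback.condition.symm.trans (Category.comp_id _).symm

/-- A refinement of coverings of `S` induces one between the base changed coverings. -/
def toPullback (m : CoverMap (𝟙 S) 𝒱₀ 𝒰) (f : S' ⟶ S) :
    CoverMap (𝟙 S') (pullbackCover f 𝒱₀) (pullbackCover f 𝒰) where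
  idx := m.idx
  hom := fun i : 𝒱₀.I₀ ↦
    pullback.lift (pullback.fst f (𝒱₀.f i)) (pullback.snd f (𝒱₀.f i) ≫ m.hom i)
      (by simp [m.comm, pullback.condition])
  comm _ := (pullback.lift_fst _ _ _).trans (Category.comp_id _).symm

end CoverMap

/-- Two Čech 1-cocycles on étale coverings of `S` are equivalent if they become cohomologous on a
common refinement of the two coverings. -/
def cechSetoid (S : Scheme.{u}) (G : Type w) [Group G] :
    Setoid (Σ 𝒰 : EtaleCover S, Cocycle G 𝒰) where
  r x y := ∃ (𝒲 : EtaleCover S) (m : CoverMap (𝟙 S) 𝒲 x.1) (n : CoverMap (𝟙 S) 𝒲 y.1),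
    (m.pullbackCocycle x.2).IsCohomologous (n.pullbackCocycle y.2)
  iseqv :=
    { refl := fun x ↦
        ⟨x.1, ⟨id, fun _ ↦ 𝟙 _, fun _ ↦ by simp⟩, ⟨id, fun _ ↦ 𝟙 _, fun _ ↦ by simp⟩,
          CoverMap.isCohomologous_of_maps _ _ _⟩
      symm := fun ⟨𝒲, m, n, h⟩ ↦
        ⟨𝒲, n, m, (OneCocycle.equivalence_isCohomologous _ _).symm h⟩
      trans := by
        rintro x y z ⟨𝒲, m, n, h⟩ ⟨𝒲', m', n', h'⟩
        have e : 𝟙 S ≫ 𝟙 S = 𝟙 S := Category.comp_id _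
        let a := CoverMap.interFst 𝒲 𝒲'
        let b := CoverMap.interSnd 𝒲 𝒲'
        refine ⟨interCover 𝒲 𝒲', (a.comp m).cast e, (b.comp n').cast e, ?_⟩
        have h₁ : (((a.comp m).cast e).pullbackCocycle x.2).IsCohomologous
            (((a.comp n).cast e).pullbackCocycle y.2) := by
          rw [CoverMap.pullbackCocycle_cast, CoverMap.pullbackCocycle_cast,
            CoverMap.pullbackCocycle_comp, CoverMap.pullbackCocycle_comp]
          exact a.isCohomologous_pullback h
        have h₃ : (((b.comp m').cast e).pullbackCocycle y.2).IsCohomologous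
            (((b.comp n').cast e).pullbackCocycle z.2) := by
          rw [CoverMap.pullbackCocycle_cast, CoverMap.pullbackCocycle_cast,
            CoverMap.pullbackCocycle_comp, CoverMap.pullbackCocycle_comp]
          exact b.isCohomologous_pullback h'
        have h₂ := CoverMap.isCohomologous_of_maps ((a.comp n).cast e) ((b.comp m').cast e) y.2
        have E := OneCocycle.equivalence_isCohomologous (constSheafOver S G)
          (fun i : (interCover 𝒲 𝒲').I₀ ↦ Over.mk ((interCover 𝒲 𝒲').f i))
        exact E.trans h₁ (E.trans h₂ h₃) }

/-- The Čech cohomology set `Ȟ¹(S, G)` of the constant sheaf of groups attached to `G` in the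
étale topology of `S`: the colimit over all étale coverings of their Čech cohomology sets. -/
def H1 (S : Scheme.{u}) (G : Type w) [Group G] : Type (max (u + 1) w) :=
  Quotient (cechSetoid S G)

/-- The pullback map `Ȟ¹(S, G) → Ȟ¹(S', G)` along a morphism `f : S' ⟶ S`. -/
def H1.pullback {S' S : Scheme.{u}} (f : S' ⟶ S) (G : Type w) [Group G] : H1 S G → H1 S' G :=
  Quotient.map (fun x ↦ ⟨pullbackCover f x.1, (CoverMap.ofPullback f x.1).pullbackCocycle x.2⟩) (by
    rintro x y ⟨𝒲, m, n, h⟩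
    refine ⟨pullbackCover f 𝒲, m.toPullback f, n.toPullback f, ?_⟩
    let q := CoverMap.ofPullback f 𝒲
    have E := OneCocycle.equivalence_isCohomologous (constSheafOver S' G)
      (fun i : (pullbackCover f 𝒲).I₀ ↦ Over.mk ((pullbackCover f 𝒲).f i))
    have e₁ : 𝟙 S' ≫ f = f := Category.id_comp f
    have e₂ : f ≫ 𝟙 S = f := Category.comp_id f
    have key : ∀ (z : Σ 𝒰 : EtaleCover S, Cocycle G 𝒰) (r : CoverMap (𝟙 S) 𝒲 z.1),
        ((r.toPullback f).pullbackCocycle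
          ((CoverMap.ofPullback f z.1).pullbackCocycle z.2)).IsCohomologous
          (q.pullbackCocycle (r.pullbackCocycle z.2)) := by
      intro z r
      rw [← CoverMap.pullbackCocycle_comp, ← CoverMap.pullbackCocycle_comp,
        ← CoverMap.pullbackCocycle_cast _ e₁, ← CoverMap.pullbackCocycle_cast _ e₂]
      exact CoverMap.isCohomologous_of_maps _ _ _
    exact E.trans (key x m) (E.trans (q.isCohomologous_pullback h) (E.symm (key y n))))

/-! ### The formal punctured neighbourhood of a rational point of a curve -/

section Curve

variable {k : Type u} [Field k] {Y : Scheme.{u}}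

/-- The underlying point of a `k`-point of `Y`. -/
def point (y : Spec (.of k) ⟶ Y) : Y := y (IsLocalRing.closedPoint k)

/-- The local ring of `Y` at the `k`-point `y`. -/
abbrev localRing (y : Spec (.of k) ⟶ Y) : Type u := Y.presheaf.stalk (point y)

/-- The completed local ring of `Y` at the `k`-point `y`. -/
abbrev completedLocalRing (y : Spec (.of k) ⟶ Y) : Type u :=
  AdicCompletion (IsLocalRing.maximalIdeal (localRing y)) (localRing y)

/-- The structure map from `k` to the local ring at `y` of the `k`-scheme `Y`. -/
def constToLocalRing (π : Y ⟶ Spec (.of k)) (y : Spec (.of k) ⟶ Y) : k →+* localRing y :=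
  ((Scheme.ΓSpecIso (.of k)).inv ≫ π.appTop ≫ Y.presheaf.germ ⊤ (point y) trivial).hom

/-- The choice of an isomorphism of `k`-algebras from the completed local ring at `y` to `k⟦t⟧`. -/
structure FormalCoordinate (π : Y ⟶ Spec (.of k)) (y : Spec (.of k) ⟶ Y) where
  /-- The isomorphism. -/
  equiv : completedLocalRing y ≃+* k⟦X⟧
  map_const (c : k) :
    equiv (algebraMap (localRing y) (completedLocalRing y) (constToLocalRing π y c)) =
      PowerSeries.C c

/-- The complement `Y'` of the `k`-point `y` of the separated `k`-scheme `Y`. -/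
def complement (π : Y ⟶ Spec (.of k)) [IsSeparated π] (y : Spec (.of k) ⟶ Y) (hy : y ≫ π = 𝟙 _) :
    Y.Opens where
  carrier := {point y}ᶜ
  is_open' := by
    have : IsClosedImmersion (y ≫ π) := hy ▸ inferInstance
    have : IsClosedImmersion y := .of_comp y π
    have h : IsClosed (Set.range y) := y.isClosedEmbedding.isClosed_range
    have h' : Set.range y = {point y} := by
      ext z
      constructor
      · rintro ⟨x, rfl⟩
        exact congrArg y (Subsingleton.elim (α := PrimeSpectrum k) x _)
      · rintro rfl
        exact ⟨_, rfl⟩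
    rw [h'] at h
    exact h.isOpen_compl

namespace FormalCoordinate

variable {π : Y ⟶ Spec (.of k)} {y : Spec (.of k) ⟶ Y}

/-- The expansion of germs of functions at `y` as Laurent series. -/
def expand (e : FormalCoordinate π y) : localRing y →+* k⸨X⸩ :=
  ((algebraMap k⟦X⟧ k⸨X⸩).comp (e.equiv : completedLocalRing y →+* k⟦X⟧)).comp
    (algebraMap (localRing y) (completedLocalRing y))

/-- The morphism `Spec k((t)) ⟶ Y` through the spectra of `k⟦t⟧` and of the local ring at `y`. -/
def toCurve (e : FormalCoordinate π y) : Spec (.of k⸨X⸩) ⟶ Y :=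
  Spec.map (CommRingCat.ofHom e.expand) ≫ Y.fromSpecStalk (point y)

lemma exists_expand_ne_zero (e : FormalCoordinate π y) :
    ∃ a ∈ IsLocalRing.maximalIdeal (localRing y), e.expand a ≠ 0 := by
  by_contra! H
  set m := IsLocalRing.maximalIdeal (localRing y) with hm
  have h0 : ∀ a ∈ m, algebraMap (localRing y) (completedLocalRing y) a = 0 := by
    intro a ha
    have h1 := H a ha
    have h2 : Function.Injective (algebraMap k⟦X⟧ k⸨X⸩) := IsFractionRing.injective _ _
    exact e.equiv.injective ((h2 (h1.trans (map_zero _).symm)).trans (map_zero _).symm)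
  have hpow : ∀ n, m ≤ m ^ n := by
    intro n a ha
    have h1 := congrArg (AdicCompletion.evalₐ m n) (h0 a ha)
    rw [map_zero, AlgHom.commutes] at h1
    exact Ideal.Quotient.eq_zero_iff_mem.mp h1
  have hsurj : Function.Surjective (algebraMap (localRing y) (completedLocalRing y)) := by
    intro z
    obtain ⟨x, rfl⟩ := AdicCompletion.mk_surjective m (localRing y) z
    refine ⟨x 1, AdicCompletion.ext_evalₐ fun n ↦ ?_⟩
    rw [AlgHom.commutes, AdicCompletion.evalₐ_mk]
    refine Ideal.Quotient.eq.mpr ?_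
    rcases Nat.eq_zero_or_pos n with rfl | hn
    · simp
    · have h1 : x.val 1 - x.val n ∈ (m ^ 1 • ⊤ : Ideal (localRing y)) :=
        SModEq.sub_mem.mp (x.property hn)
      exact hpow n (by simpa using h1)
  obtain ⟨r, hr⟩ := hsurj (e.equiv.symm PowerSeries.X)
  have hr' : e.equiv (algebraMap (localRing y) (completedLocalRing y) r) = PowerSeries.X := by
    rw [hr, RingEquiv.apply_symm_apply]
  by_cases hrm : r ∈ m
  · rw [h0 r hrm, map_zero] at hr'
    exact PowerSeries.X_ne_zero hr'.symm
  · have hu : IsUnit r := by simpa [hm] using hrm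
    have := (hu.map (algebraMap (localRing y) (completedLocalRing y))).map e.equiv
    rw [hr'] at this
    exact PowerSeries.X_prime.not_isUnit this

lemma range_toCurve [IsSeparated π] (e : FormalCoordinate π y) (hy : y ≫ π = 𝟙 _) :
    Set.range e.toCurve ⊆ Set.range (complement π y hy).ι := by
  rw [Scheme.Opens.range_ι]
  rintro _ ⟨x, rfl⟩ (hx : e.toCurve x = point y)
  obtain ⟨a, ha, hne⟩ := e.exists_expand_ne_zero
  rw [toCurve, Scheme.Hom.comp_apply] at hx
  have h := (Y.fromSpecStalk (point y)).isEmbedding.injective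
    (hx.trans Scheme.fromSpecStalk_closedPoint.symm)
  have ha' : a ∈ (Spec.map (CommRingCat.ofHom e.expand) x).asIdeal := by
    rw [h]; exact ha
  have ha'' : e.expand a ∈ PrimeSpectrum.asIdeal x := ha'
  have : IsUnit (e.expand a) := isUnit_iff_ne_zero.mpr hne
  exact x.isPrime.ne_top (Ideal.eq_top_of_isUnit_mem _ ha'' this)

/-- The morphism `Spec k((t)) ⟶ Y'`, the inclusion of the formal punctured neighbourhood of `y`. -/
def toComplement [IsSeparated π] (e : FormalCoordinate π y) (hy : y ≫ π = 𝟙 _) :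
    Spec (.of k⸨X⸩) ⟶ (complement π y hy : Scheme.{u}) :=
  IsOpenImmersion.lift (complement π y hy).ι e.toCurve (e.range_toCurve hy)

/-- The restriction map `𝒪(Y') → k((t))`. -/
def restrict [IsSeparated π] (e : FormalCoordinate π y) (hy : y ≫ π = 𝟙 _) :
    Γ(complement π y hy, ⊤) →+* k⸨X⸩ :=
  ((e.toComplement hy).appTop ≫ (Scheme.ΓSpecIso (.of k⸨X⸩)).hom).hom

/-- The map `Ψ : Ȟ¹(Y', G) → Ȟ¹(Spec k((t)), G)`. -/
def Psi [IsSeparated π] (e : FormalCoordinate π y) (hy : y ≫ π = 𝟙 _) (G : Type w) [Group G] :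
    H1 (complement π y hy : Scheme.{u}) G → H1 (Spec (.of k⸨X⸩)) G :=
  H1.pullback (e.toComplement hy) G

end FormalCoordinate

end Curve

/-- The Artin–Schreier map `f ↦ f ^ p - f`. -/
def artinSchreier (p : ℕ) {R : Type*} [CommRing R] (f : R) : R := f ^ p - f

end

end LocalGlobal

/-!
The stalks of `Y` are principal ideal domains, and properness of `Y` makes the functions regular
where a nonconstant function `x` is into a finitely generated `k[x]`-module. For the opens `U`, `V`
where `x`, respectively `x⁻¹`, is regular, this bounds `𝒪(U ∩ V) / (𝒪(U) + 𝒪(V))`, so a polynomial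
in a function with a pole at `y` splits into an element of `𝒪(U)` and one of `𝒪(V)`. This produces
a function whose only pole is `y`; it makes `Y'` finite over the affine line, hence affine.

On an affine scheme `S` with `p = 0`, faithfully flat descent and the coverings `x ^ p - x = c`
identify `H¹(S, ℤ/p)` with the cokernel of `℘` on `𝒪(S)`. As `𝒪(Y')` embeds into `k((t))`,
condition (i) says precisely that `Ψ` has trivial kernel, hence is injective, for `ℤ/p`.

Two `G`-torsors are isomorphic if and only if the form of `G` twisted by the one from the left and
by the other from the right has a section. For a `p`-group `G`, the structure group `G × G` of this
form is a `p`-group, and a section over `Spec k((t))` either has a value fixed by the structure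
group, or reduces that group to the kernel of a surjection to `ℤ/p`. If `Ψ` is injective for `ℤ/p`,
this reduction exists already over `Y'`, and induction applies. Conversely, a central subgroup of
order `p` embeds `H¹(-, ℤ/p)` into `H¹(-, G)`.
-/

namespace LocalGlobal

/-! ### Local rings of smooth curves -/

section StalksOfCurves

lemma isPrincipal_maximalIdeal_of_formallyUnramified {R S : Type*} [CommRing R] [CommRing S]
    [Algebra R S] [IsPrincipalIdealRing R] [Algebra.EssFiniteType R S]
    [Algebra.FormallyUnramified R S] (q : Ideal S) [q.IsPrime] :
    (IsLocalRing.maximalIdeal (Localization.AtPrime q)).IsPrincipal := by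
  let p := q.under R
  let := Localization.AtPrime.algebraOfLiesOver p q
  have h : Algebra.IsUnramifiedAt R q := inferInstanceAs
    (Algebra.FormallyUnramified R (Localization.AtPrime q))
  rw [← ((Algebra.isUnramifiedAt_iff_map_eq R p q).mp h).2]
  infer_instance

lemma isPrincipalIdealRing_mvPolynomial_of_unique (σ : Type*) [Unique σ] {R : Type*} [CommRing R]
    (hR : IsField R) : IsPrincipalIdealRing (MvPolynomial σ R) := by
  let := hR.toField
  let e := (MvPolynomial.uniqueAlgEquiv R σ).symm
  exact .of_surjective (e : Polynomial R →+* MvPolynomial σ R) e.surjective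

variable {k : Type u} [Field k] {Y : Scheme.{u}}

lemma isField_Γ_spec (U : (Spec (.of k)).Opens) [Nonempty U] : IsField Γ(Spec (.of k), U) := by
  obtain ⟨x, hx⟩ := ‹Nonempty U›
  obtain rfl : U = ⊤ := by
    ext z
    obtain rfl : z = x := Subsingleton.elim (α := PrimeSpectrum k) z x
    simp [hx]
  exact (Scheme.ΓSpecIso (.of k)).commRingCatIsoToRingEquiv.toMulEquiv.isField (Field.toIsField k)

lemma isPrincipal_maximalIdeal_stalk (π : Y ⟶ Spec (.of k)) [SmoothOfRelativeDimension 1 π]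
    (z : Y) : (IsLocalRing.maximalIdeal (Y.presheaf.stalk z)).IsPrincipal := by
  obtain ⟨U, -, V, hV, hz, hVU, hstd⟩ :=
    SmoothOfRelativeDimension.exists_isStandardSmoothOfRelativeDimension (n := 1) (f := π) z
  -- Near `z`, the curve is étale over the affine line, whose coordinate ring is principal.
  obtain ⟨g, -, hg⟩ := hstd.exists_etale_mvPolynomial
  have : Nonempty U := ⟨⟨π z, hVU hz⟩⟩
  have := isPrincipalIdealRing_mvPolynomial_of_unique (Fin 1) (isField_Γ_spec U)
  algebraize [g]
  let q := (hV.primeIdealOf ⟨z, hz⟩).asIdeal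
  have hq := isPrincipal_maximalIdeal_of_formallyUnramified
    (R := MvPolynomial (Fin 1) Γ(Spec (.of k), U)) q
  let : Algebra Γ(Y, V) (Y.presheaf.stalk z) := Y.presheaf.algebra_section_stalk ⟨z, hz⟩
  have : IsLocalization.AtPrime (Y.presheaf.stalk z) q := hV.isLocalization_stalk ⟨z, hz⟩
  let e := (IsLocalization.algEquiv q.primeCompl (Localization.AtPrime q)
    (Y.presheaf.stalk z)).toRingEquiv
  rw [← IsLocalRing.map_maximalIdeal_of_surjective
    (e : Localization.AtPrime q →+* Y.presheaf.stalk z) e.surjective]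
  infer_instance

lemma isPrincipalIdealRing_stalk [IsIntegral Y] [IsLocallyNoetherian Y] (π : Y ⟶ Spec (.of k))
    [SmoothOfRelativeDimension 1 π] (z : Y) : IsPrincipalIdealRing (Y.presheaf.stalk z) :=
  ((tfae_of_isNoetherianRing_of_isLocalRing_of_isDomain (Y.presheaf.stalk z)).out 4 0).mp
    (isPrincipal_maximalIdeal_stalk π z)

end StalksOfCurves

section DimensionLEOne

variable {Y : Scheme.{u}} [IsIntegral Y] [∀ z : Y, Ring.DimensionLEOne (Y.presheaf.stalk z)]

lemma eq_of_specializes_of_ne_genericPoint {z z' : Y} (h : z ⤳ z') (hz : z ≠ genericPoint Y) :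
    z = z' := by
  obtain ⟨q, rfl⟩ : z ∈ Set.range (Y.fromSpecStalk z') := by rwa [Scheme.range_fromSpecStalk]
  have hq : q.asIdeal ≠ ⊥ := by
    intro hq
    obtain ⟨q₀, hq₀⟩ : genericPoint Y ∈ Set.range (Y.fromSpecStalk z') := by
      rw [Scheme.range_fromSpecStalk]; exact genericPoint_specializes z'
    have hqq₀ : q ⤳ q₀ :=
      (PrimeSpectrum.le_iff_specializes q q₀).mp (show q.asIdeal ≤ q₀.asIdeal from hq ▸ bot_le)
    have := hqq₀.map (Y.fromSpecStalk z').continuous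
    rw [hq₀] at this
    exact hz (this.antisymm (genericPoint_specializes _)).eq
  obtain rfl : q = IsLocalRing.closedPoint (Y.presheaf.stalk z') :=
    PrimeSpectrum.ext (IsLocalRing.eq_maximalIdeal (q.isPrime.isMaximal hq))
  exact Scheme.fromSpecStalk_closedPoint

lemma isClosed_singleton_of_ne_genericPoint {z : Y} (hz : z ≠ genericPoint Y) : IsClosed {z} := by
  rw [← closure_subset_iff_isClosed]
  intro z' h
  exact (eq_of_specializes_of_ne_genericPoint (specializes_iff_mem_closure.mpr h) hz).symm

lemma finite_of_isClosed_of_genericPoint_notMem [TopologicalSpace.NoetherianSpace Y] {Z : Set Y}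
    (hZ : IsClosed Z) (hη : genericPoint Y ∉ Z) : Z.Finite := by
  obtain ⟨S, hS, hclosed, hirr, rfl⟩ :=
    TopologicalSpace.NoetherianSpace.exists_finite_set_isClosed_irreducible hZ
  refine hS.sUnion fun t ht ↦ ?_
  have hgen : IsGenericPoint (hirr t ht).genericPoint t := by
    simpa only [(hclosed t ht).closure_eq] using (hirr t ht).isGenericPoint_genericPoint_closure
  have hne : (hirr t ht).genericPoint ≠ genericPoint Y := fun h ↦ hη ⟨t, ht, h ▸ hgen.mem⟩
  rw [← hgen.def, (isClosed_singleton_of_ne_genericPoint hne).closure_eq]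
  exact Set.finite_singleton _

end DimensionLEOne

/-! ### Rational functions and their domains -/

section RegularFunctions

variable {Y : Scheme.{u}} [IsIntegral Y]

/-- The local ring at `z` of an integral scheme, as a subring of the function field. -/
noncomputable def localSubring (z : Y) : Subring Y.functionField :=
  (algebraMap (Y.presheaf.stalk z) Y.functionField).range

lemma genericPoint_mem (U : Y.Opens) {z : Y} (hz : z ∈ U) : genericPoint Y ∈ U :=
  (genericPoint_specializes z).mem_open U.2 hz

lemma algebraMap_germ {U : Y.Opens} {z : Y} (hz : z ∈ U) (a : Γ(Y, U)) :
    algebraMap (Y.presheaf.stalk z) Y.functionField (Y.presheaf.germ U z hz a) =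
      Y.presheaf.germ U (genericPoint Y) (genericPoint_mem U hz) a :=
  have : Nonempty U := ⟨⟨z, hz⟩⟩
  Scheme.algebraMap_germ_eq_germToFunctionField Y hz a

lemma germ_genericPoint_mem_localSubring {U : Y.Opens} {z : Y} (hz : z ∈ U) (a : Γ(Y, U)) :
    Y.presheaf.germ U (genericPoint Y) (genericPoint_mem U hz) a ∈ localSubring z :=
  ⟨_, algebraMap_germ hz a⟩

lemma exists_section_of_mem_localSubring {f : Y.functionField} {z : Y} (hf : f ∈ localSubring z) :
    ∃ (U : Y.Opens) (hz : z ∈ U) (a : Γ(Y, U)),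
      Y.presheaf.germ U (genericPoint Y) (genericPoint_mem U hz) a = f := by
  obtain ⟨s, rfl⟩ := hf
  obtain ⟨U, hz, a, rfl⟩ := Y.presheaf.exists_germ_eq s
  exact ⟨U, hz, a, (algebraMap_germ hz a).symm⟩

/-- The domain of definition of the rational function `f`. -/
def dom (f : Y.functionField) : Y.Opens where
  carrier := {z | f ∈ localSubring z}
  is_open' := by
    rw [isOpen_iff_forall_mem_open]
    intro z hz
    obtain ⟨U, hzU, a, rfl⟩ := exists_section_of_mem_localSubring hz
    exact ⟨U, fun z' hz' ↦ germ_genericPoint_mem_localSubring hz' a, U.2, hzU⟩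

@[simp]
lemma mem_dom {f : Y.functionField} {z : Y} : z ∈ dom f ↔ f ∈ localSubring z := Iff.rfl

lemma genericPoint_mem_dom (f : Y.functionField) : genericPoint Y ∈ dom f := by
  obtain ⟨U, hU, a, rfl⟩ := Y.presheaf.exists_germ_eq f
  exact germ_genericPoint_mem_localSubring hU a

lemma germ_genericPoint_injective {U : Y.Opens} (h : genericPoint Y ∈ U) :
    Function.Injective (Y.presheaf.germ U (genericPoint Y) h) :=
  germ_injective_of_isIntegral _ _ _

lemma exists_section_of_le_dom {f : Y.functionField} {U : Y.Opens} (h : genericPoint Y ∈ U)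
    (hU : U ≤ dom f) : ∃ a : Γ(Y, U), Y.presheaf.germ U (genericPoint Y) h a = f := by
  choose V hV a ha using fun z : U ↦ exists_section_of_mem_localSubring (hU z.2)
  let W (z : U) : Y.Opens := V z ⊓ U
  have hW (z : U) : genericPoint Y ∈ W z := genericPoint_mem (W z) ⟨hV z, z.2⟩
  let b (z : U) : Γ(Y, W z) := Y.presheaf.map (homOfLE inf_le_left).op (a z)
  have hb (z : U) : Y.presheaf.germ (W z) (genericPoint Y) (hW z) (b z) = f :=
    (Y.presheaf.germ_res_apply (homOfLE inf_le_left) _ (hW z) (a z)).trans (ha z)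
  have hcompat : TopCat.Presheaf.IsCompatible Y.presheaf W b := by
    intro z z'
    apply germ_genericPoint_injective (U := W z ⊓ W z') ⟨hW z, hW z'⟩
    refine (Y.presheaf.germ_res_apply _ _ _ _).trans
      (.trans ?_ (Y.presheaf.germ_res_apply _ _ _ _).symm)
    rw [hb, hb]
  obtain ⟨s, hs, -⟩ := Y.sheaf.existsUnique_gluing' W U (fun z ↦ homOfLE inf_le_right)
    (fun z hz ↦ TopologicalSpace.Opens.mem_iSup.mpr ⟨⟨z, hz⟩, hV _, hz⟩) b hcompat
  refine ⟨s, ?_⟩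
  rw [← hb ⟨_, h⟩, ← hs ⟨_, h⟩]
  exact (Y.presheaf.germ_res_apply _ _ _ _).symm

end RegularFunctions
/-! ### Rational functions as morphisms to the affine line -/

section PullbackOfSections

lemma le_preimage_top {X Y : Scheme.{u}} (f : X ⟶ Y) (U : X.Opens) : U ≤ f ⁻¹ᵁ ⊤ :=
  fun _ _ ↦ trivial

lemma appLE_of_eq_comp_ι {X Y : Scheme.{u}} {U : Y.Opens} {g : X ⟶ Y} {i : X ⟶ (U : Scheme.{u})}
    (hg : g = i ≫ U.ι) (h : ⊤ ≤ g ⁻¹ᵁ U) (a : Γ(Y, U)) :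
    g.appLE U ⊤ h a = i.appTop (U.topIso.inv a) := by
  subst hg
  have hι : U.ι.appLE U ⊤ (Scheme.Opens.ι_preimage_self U).ge = U.topIso.inv := by
    rw [Scheme.Opens.ι_appLE]; rfl
  have hi : i.appTop = i.appLE ⊤ ⊤ (le_preimage_top i ⊤) := i.app_eq_appLE
  rw [← CommRingCat.comp_apply, ← hι, hi, Scheme.Hom.appLE_comp_appLE]

lemma appLE_mul_appLE_eq_one {X Y : Scheme.{u}} (g : X ⟶ Y) {U V : Y.Opens} {W : X.Opens}
    (hU : W ≤ g ⁻¹ᵁ U) (hV : W ≤ g ⁻¹ᵁ V) {a : Γ(Y, U)} {b : Γ(Y, V)}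
    (h : Y.presheaf.map (homOfLE (inf_le_left : U ⊓ V ≤ U)).op a *
        Y.presheaf.map (homOfLE (inf_le_right : U ⊓ V ≤ V)).op b = 1) :
    g.appLE U W hU a * g.appLE V W hV b = 1 := by
  have hUV : W ≤ g ⁻¹ᵁ (U ⊓ V) := fun x hx ↦ ⟨hU hx, hV hx⟩
  have h' := congrArg (g.appLE (U ⊓ V) W hUV) h
  rwa [map_mul, map_one, ← CommRingCat.comp_apply, ← CommRingCat.comp_apply,
    Scheme.Hom.map_appLE, Scheme.Hom.map_appLE] at h'

lemma appTop_specMap_injective {R S : CommRingCat.{u}} {φ : R ⟶ S} (hφ : Function.Injective φ) :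
    Function.Injective (Spec.map φ).appTop := by
  intro a b h
  apply (Scheme.ΓSpecIso R).commRingCatIsoToRingEquiv.injective
  apply hφ
  have := congrArg (Scheme.ΓSpecIso S).hom h
  rwa [← CommRingCat.comp_apply, ← CommRingCat.comp_apply, Scheme.ΓSpecIso_naturality φ] at this

lemma eq_of_comp_eq_of_appTop_injective {X' X Z : Scheme.{u}} [IsAffine Z] {q : X' ⟶ X}
    (hq : Function.Injective q.appTop) {u v : X ⟶ Z} (h : q ≫ u = q ≫ v) : u = v := by
  have := congrArg Scheme.Hom.appTop h
  rw [Scheme.Hom.comp_appTop, Scheme.Hom.comp_appTop] at this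
  exact ext_of_isAffine (CommRingCat.hom_ext (RingHom.ext fun g ↦ hq congr($this g)))

lemma preimage_eq_top_of_forall_specializes {X Y : Scheme.{u}} (l : X ⟶ Y) {x : X}
    (hx : ∀ x', x' ⤳ x) {U : Y.Opens} (hU : l x ∈ U) : l ⁻¹ᵁ U = ⊤ :=
  top_le_iff.mp fun x' _ ↦ ((hx x').map l.continuous).mem_open U.2 hU

end PullbackOfSections

section AffineLine

open Polynomial

variable {k : Type u} [Field k] {Y : Scheme.{u}} (π : Y ⟶ Spec (.of k))

/-- The structure map from `k` to the sections over `U` of the `k`-scheme `Y`. -/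
noncomputable def constSection (U : Y.Opens) : k →+* Γ(Y, U) :=
  ((Scheme.ΓSpecIso (.of k)).inv ≫ π.appLE ⊤ U (le_preimage_top π U)).hom

/-- The morphism to the affine line given by a section. -/
noncomputable def toAffineLine {U : Y.Opens} (a : Γ(Y, U)) : (U : Scheme.{u}) ⟶ Spec (.of k[X]) :=
  U.toSpecΓ ≫ Spec.map (CommRingCat.ofHom (eval₂RingHom (constSection π U) a))

lemma toAffineLine_comp {U : Y.Opens} (a : Γ(Y, U)) :
    toAffineLine π a ≫ Spec.map (CommRingCat.ofHom C) = U.ι ≫ π := by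
  have h : CommRingCat.ofHom (C : k →+* k[X]) ≫
      CommRingCat.ofHom (eval₂RingHom (constSection π U) a) =
        (Scheme.ΓSpecIso (.of k)).inv ≫ π.appLE ⊤ U (le_preimage_top π U) := by
    ext c
    simp [constSection]
  rw [toAffineLine, Category.assoc, ← Spec.map_comp, h, Spec.map_comp,
    Scheme.Opens.toSpecΓ_SpecMap_appLE_assoc]
  simp

lemma toAffineLine_appTop {U : Y.Opens} (a : Γ(Y, U)) (g : k[X]) :
    (toAffineLine π a).appTop ((Scheme.ΓSpecIso (.of k[X])).inv g) =
      U.topIso.inv (g.eval₂ (constSection π U) a) := by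
  have h := Scheme.ΓSpecIso_inv_naturality
    (CommRingCat.ofHom (eval₂RingHom (constSection π U) a))
  rw [← CommRingCat.comp_apply, toAffineLine, Scheme.Hom.comp_appTop, ← Category.assoc, ← h,
    Scheme.Opens.toSpecΓ_appTop]
  have e : (Scheme.ΓSpecIso (.of Γ(Y, U))).inv ≫ (Scheme.ΓSpecIso Γ(Y, U)).hom = 𝟙 _ :=
    Iso.inv_hom_id _
  simp only [Category.assoc, reassoc_of% e]
  rfl

instance [LocallyOfFiniteType π] {U : Y.Opens} (a : Γ(Y, U)) :
    LocallyOfFiniteType (toAffineLine π a) := by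
  have : LocallyOfFiniteType (toAffineLine π a ≫ Spec.map (CommRingCat.ofHom C)) := by
    rw [toAffineLine_comp]; infer_instance
  exact locallyOfFiniteType_of_comp _ (Spec.map (CommRingCat.ofHom C))

instance [IsSeparated π] {U : Y.Opens} (a : Γ(Y, U)) : IsSeparated (toAffineLine π a) := by
  have : IsSeparated (toAffineLine π a ≫ Spec.map (CommRingCat.ofHom C)) := by
    rw [toAffineLine_comp]; infer_instance
  exact .of_comp _ (Spec.map (CommRingCat.ofHom C))

lemma notMem_basicOpen_eval₂ {U : Y.Opens} (a : Γ(Y, U)) {z : U} {g : k[X]}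
    (hg : g ∈ (toAffineLine π a z).asIdeal) :
    (z : Y) ∉ Y.basicOpen (g.eval₂ (constSection π U) a) := by
  intro hz
  have hz' : z ∈ U.toSpecΓ ⁻¹ᵁ PrimeSpectrum.basicOpen (g.eval₂ (constSection π U) a) := by
    rwa [Scheme.Opens.toSpecΓ_preimage_basicOpen]
  exact hz' hg

variable [IsIntegral Y]

/-- The structure map from `k` to the function field of the `k`-scheme `Y`. -/
noncomputable def constFunctionField : k →+* Y.functionField :=
  (Y.presheaf.germ ⊤ (genericPoint Y) trivial).hom.comp (constSection π ⊤)

lemma map_constSection {Y : Scheme.{u}} (π : Y ⟶ Spec (.of k)) {U V : Y.Opens} (i : U ≤ V)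
    (c : k) : Y.presheaf.map (homOfLE i).op (constSection π V c) = constSection π U c := by
  rw [constSection, constSection, ← Scheme.Hom.appLE_map π (le_preimage_top π V) (homOfLE i).op]
  rfl

lemma germ_constSection {U : Y.Opens} (h : genericPoint Y ∈ U) (c : k) :
    Y.presheaf.germ U (genericPoint Y) h (constSection π U c) = constFunctionField π c := by
  rw [← map_constSection π (le_top : U ≤ ⊤), Y.presheaf.germ_res_apply]
  rfl

lemma constFunctionField_mem (z : Y) (c : k) : constFunctionField π c ∈ localSubring z :=
  germ_genericPoint_mem_localSubring (U := ⊤) trivial _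

lemma germ_eval₂ {U : Y.Opens} (h : genericPoint Y ∈ U) (a : Γ(Y, U)) (g : k[X]) :
    Y.presheaf.germ U (genericPoint Y) h (g.eval₂ (constSection π U) a) =
      g.eval₂ (constFunctionField π) (Y.presheaf.germ U (genericPoint Y) h a) := by
  refine (hom_eval₂ g _ (Y.presheaf.germ U (genericPoint Y) h).hom a).trans ?_
  congr 1
  ext c
  exact germ_constSection π h c

end AffineLine

section Poles

open Polynomial

lemma isIntegral_of_isIntegral_eval₂ {k R A : Type*} [Field k] [CommRing R] [Nontrivial R]
    [CommRing A] [Algebra R A] (ι : k →+* R) {c : A} {P : k[X]} (hP : P.natDegree ≠ 0)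
    (h : _root_.IsIntegral R (P.eval₂ ((algebraMap R A).comp ι) c)) : _root_.IsIntegral R c := by
  have hP0 : P ≠ 0 := by rintro rfl; exact hP natDegree_zero
  refine .of_aeval_monic (p := (P * C P.leadingCoeff⁻¹).map ι)
    ((monic_mul_leadingCoeff_inv hP0).map _) ?_ ?_
  · rwa [natDegree_map, natDegree_mul_C (by simpa using hP0)]
  · rw [aeval_def, eval₂_map, eval₂_mul, eval₂_C]
    exact h.mul isIntegral_algebraMap

variable {k : Type u} [Field k] {Y : Scheme.{u}} (π : Y ⟶ Spec (.of k)) [IsIntegral Y]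

lemma mem_or_inv_mem_localSubring (z : Y) [ValuationRing (Y.presheaf.stalk z)]
    (f : Y.functionField) : f ∈ localSubring z ∨ f⁻¹ ∈ localSubring z :=
  ValuationRing.isInteger_or_isInteger (Y.presheaf.stalk z) f

lemma eval₂_ne_zero_of_notMem_localSubring {z : Y} [IsIntegrallyClosed (Y.presheaf.stalk z)]
    {f : Y.functionField} (hf : f ∉ localSubring z) {g : k[X]} (hg : g ≠ 0) :
    g.eval₂ (constFunctionField π) f ≠ 0 := by
  by_cases hdeg : g.natDegree = 0
  · obtain ⟨c, rfl⟩ := natDegree_eq_zero.mp hdeg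
    simpa using hg
  · contrapose hf
    let ι : k →+* Y.presheaf.stalk z := (Y.presheaf.germ ⊤ z trivial).hom.comp (constSection π ⊤)
    have hι : (algebraMap (Y.presheaf.stalk z) Y.functionField).comp ι = constFunctionField π := by
      ext c
      exact algebraMap_germ (U := ⊤) trivial _
    refine IsIntegrallyClosed.isIntegral_iff.mp (isIntegral_of_isIntegral_eval₂ ι hdeg ?_)
    rw [hι, hf]
    exact isIntegral_zero

lemma eval₂_ne_zero_of_inv_notMem_localSubring {z : Y} [IsIntegrallyClosed (Y.presheaf.stalk z)]
    {f : Y.functionField} (hf : f⁻¹ ∉ localSubring z) {g : k[X]} (hg : g ≠ 0) :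
    g.eval₂ (constFunctionField π) f ≠ 0 := by
  have hf0 : f ≠ 0 := by
    rintro rfl
    exact hf (by rw [inv_zero]; exact zero_mem _)
  let : Invertible f := invertibleOfNonzero hf0
  rw [← eval₂_reverse_mul_pow (constFunctionField π) f g, invOf_eq_inv]
  exact mul_ne_zero (eval₂_ne_zero_of_notMem_localSubring π hf (by simpa using hg))
    (pow_ne_zero _ hf0)

lemma inv_germ_mem_localSubring_iff {U : Y.Opens} {z : Y} (hz : z ∈ U) {a : Γ(Y, U)}
    (ha : Y.presheaf.germ U (genericPoint Y) (genericPoint_mem U hz) a ≠ 0) :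
    (Y.presheaf.germ U (genericPoint Y) (genericPoint_mem U hz) a)⁻¹ ∈ localSubring z ↔
      z ∈ Y.basicOpen a := by
  rw [Scheme.mem_basicOpen _ _ _ hz, isUnit_iff_exists_inv]
  refine exists_congr fun b ↦ ?_
  rw [← (IsFractionRing.injective (Y.presheaf.stalk z) Y.functionField).eq_iff, map_mul, map_one,
    algebraMap_germ hz, mul_comm]
  exact (mul_eq_one_iff_eq_inv₀ ha).symm

end Poles
section FiniteOverAffineLine

open Polynomial

variable {k : Type u} [Field k] {Y : Scheme.{u}} [IsIntegral Y]

lemma apply_mem_dom_of_appTop_eq {X' X : Scheme.{u}} {q : X' ⟶ X}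
    (hq : Function.Injective q.appTop) (l : X ⟶ Y) {x : X} (hx : ∀ x', x' ⤳ x)
    {f : Y.functionField} (hf : f ∈ localSubring (l x) ∨ f⁻¹ ∈ localSubring (l x))
    {a : Γ(Y, dom f)} (ha : Y.presheaf.germ (dom f) (genericPoint Y) (genericPoint_mem_dom f) a = f)
    (hd : ⊤ ≤ (q ≫ l) ⁻¹ᵁ dom f) {r : Γ(X, ⊤)} (hr : q.appTop r = (q ≫ l).appLE (dom f) ⊤ hd a) :
    l x ∈ dom f := by
  -- Near a pole of `f` its inverse is a section `σ`, and `σ r = 1` forbids `σ` to vanish at `l x`.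
  by_contra hpole
  have hf0 : f ≠ 0 := fun h ↦ hpole (h ▸ zero_mem (localSubring _))
  obtain ⟨W, hxW, σ, hσ⟩ := exists_section_of_mem_localSubring (hf.resolve_left hpole)
  have hW : l ⁻¹ᵁ W = ⊤ := preimage_eq_top_of_forall_specializes l hx hxW
  have hqW : ⊤ ≤ (q ≫ l) ⁻¹ᵁ W := by
    rw [Scheme.Hom.comp_preimage, hW]; exact le_preimage_top _ _
  have hσa : Y.presheaf.map (homOfLE (inf_le_left : W ⊓ dom f ≤ W)).op σ *
      Y.presheaf.map (homOfLE (inf_le_right : W ⊓ dom f ≤ dom f)).op a = 1 := by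
    have hη : genericPoint Y ∈ W ⊓ dom f := ⟨genericPoint_mem W hxW, genericPoint_mem_dom f⟩
    apply germ_genericPoint_injective hη
    rw [map_mul, map_one, Y.presheaf.germ_res_apply, Y.presheaf.germ_res_apply, hσ, ha,
      inv_mul_cancel₀ hf0]
  have hσr : l.appLE W ⊤ hW.ge σ * r = 1 := by
    apply hq
    have hq' : l.appLE W ⊤ hW.ge ≫ q.appTop = (q ≫ l).appLE W ⊤ hqW :=
      (congrArg _ q.app_eq_appLE).trans (Scheme.Hom.appLE_comp_appLE ..)
    rw [map_mul, map_one, hr, ← CommRingCat.comp_apply, hq', appLE_mul_appLE_eq_one _ hqW hd hσa]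
  have hunit : l x ∈ Y.basicOpen σ := by
    have h := Scheme.basicOpen_of_isUnit _ (IsUnit.of_mul_eq_one _ hσr)
    rw [Scheme.basicOpen_appLE] at h
    exact (h.ge (TopologicalSpace.Opens.mem_top x)).2
  have := (inv_germ_mem_localSubring_iff hxW (by rw [hσ]; exact inv_ne_zero hf0)).mpr hunit
  rw [hσ, inv_inv] at this
  exact hpole this

variable (π : Y ⟶ Spec (.of k))

lemma exists_lift_toAffineLine {T' T : Scheme.{u}} {q : T' ⟶ T} (hq : Function.Injective q.appTop)
    {x : T} (hx : ∀ x', x' ⤳ x) {f : Y.functionField} {a : Γ(Y, dom f)}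
    (ha : Y.presheaf.germ (dom f) (genericPoint Y) (genericPoint_mem_dom f) a = f)
    (hf : ∀ z : Y, f ∈ localSubring z ∨ f⁻¹ ∈ localSubring z)
    {i₁ : T' ⟶ (dom f : Scheme.{u})} {i₂ : T ⟶ Spec (.of k[X])}
    (w : i₁ ≫ toAffineLine π a = q ≫ i₂) {l : T ⟶ Y} (hl : q ≫ l = i₁ ≫ (dom f).ι) :
    ∃ l' : T ⟶ (dom f : Scheme.{u}), q ≫ l' = i₁ ∧ l' ≫ toAffineLine π a = i₂ := by
  let ξ := (Scheme.ΓSpecIso (.of k[X])).inv X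
  have hd : ⊤ ≤ (q ≫ l) ⁻¹ᵁ dom f := by
    rw [hl]; exact fun x _ ↦ (i₁ x).2
  have hξ : q.appTop (i₂.appTop ξ) = (q ≫ l).appLE (dom f) ⊤ hd a := by
    have h₁ : q.appTop (i₂.appTop ξ) = (q ≫ i₂).appTop ξ := by
      rw [Scheme.Hom.comp_appTop]; rfl
    have h₂ : (i₁ ≫ toAffineLine π a).appTop ξ = i₁.appTop ((dom f).topIso.inv a) := by
      rw [Scheme.Hom.comp_appTop, CommRingCat.comp_apply, toAffineLine_appTop, eval₂_X]
    rw [h₁, ← w, h₂]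
    exact (appLE_of_eq_comp_ι hl hd a).symm
  have hmem : l x ∈ dom f := apply_mem_dom_of_appTop_eq hq l hx (hf _) ha hd hξ
  have hrange : Set.range l ⊆ Set.range (dom f).ι := by
    rw [Scheme.Opens.range_ι]
    rintro _ ⟨x', rfl⟩
    exact (preimage_eq_top_of_forall_specializes l hx hmem).ge (TopologicalSpace.Opens.mem_top x')
  let l' := IsOpenImmersion.lift (dom f).ι l hrange
  have hl' : q ≫ l' = i₁ := by
    rw [← cancel_mono (dom f).ι, Category.assoc, IsOpenImmersion.lift_fac, hl]
  exact ⟨l', hl', eq_of_comp_eq_of_appTop_injective hq (by rw [reassoc_of% hl', w])⟩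

lemma eq_genericPoint_of_toAffineLine_eq [LocallyOfFiniteType π]
    [∀ z : Y, Ring.DimensionLEOne (Y.presheaf.stalk z)] {U : Y.Opens} (a : Γ(Y, U))
    {z : (U : Scheme.{u})} (hz : (toAffineLine π a z).asIdeal = ⊥) : U.ι z = genericPoint Y := by
  by_contra hne
  have hclosed : IsClosed {z} := by
    rw [← Set.preimage_image_eq {z} U.ι.injective, Set.image_singleton]
    exact (isClosed_singleton_of_ne_genericPoint hne).preimage U.ι.continuous
  have : JacobsonSpace (Spec (.of k[X])) := inferInstance
  have himage := (toAffineLine π a).closePoints_subset_preimage_closedPoints hclosed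
  have hmax : (toAffineLine π a z).asIdeal.IsMaximal :=
    (PrimeSpectrum.isClosed_singleton_iff_isMaximal _).mp himage
  rw [hz] at hmax
  exact Polynomial.not_isField k (Ring.isField_iff_maximal_bot.mpr hmax)

lemma finite_setOf_notMem_localSubring [IsNoetherian Y]
    [∀ z : Y, Ring.DimensionLEOne (Y.presheaf.stalk z)] (f : Y.functionField) :
    {z : Y | f ∉ localSubring z}.Finite :=
  finite_of_isClosed_of_genericPoint_notMem (dom f).2.isClosed_compl
    (by simpa using genericPoint_mem_dom f)

variable [IsProper π] [IsNoetherian Y]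

lemma isProper_toAffineLine {f : Y.functionField} {a : Γ(Y, dom f)}
    (ha : Y.presheaf.germ (dom f) (genericPoint Y) (genericPoint_mem_dom f) a = f)
    (hf : ∀ z : Y, f ∈ localSubring z ∨ f⁻¹ ∈ localSubring z) :
    IsProper (toAffineLine π a) := by
  have : TopologicalSpace.NoetherianSpace (dom f : Scheme.{u}) :=
    inferInstanceAs (TopologicalSpace.NoetherianSpace (dom f : Set Y))
  have : QuasiCompact (toAffineLine π a) := quasiCompact_of_noetherianSpace_source _
  suffices UniversallyClosed (toAffineLine π a) from {}
  refine .of_valuativeCriterion _ ?_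
  rintro ⟨R, L, i₁, i₂, ⟨w⟩⟩
  have hπ : ValuativeCriterion.Existence π := by
    have : UniversallyClosed π := inferInstance
    rw [UniversallyClosed.eq_valuativeCriterion] at this
    exact this.1
  obtain ⟨⟨l, hl, -⟩⟩ := (hπ ⟨R, L, i₁ ≫ (dom f).ι, i₂ ≫ Spec.map (CommRingCat.ofHom C),
    ⟨by rw [Category.assoc, ← toAffineLine_comp π a, reassoc_of% w]⟩⟩).exists_lift
  obtain ⟨l', hl'⟩ := exists_lift_toAffineLine π
    (appTop_specMap_injective (φ := CommRingCat.ofHom (algebraMap R L))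
      (IsFractionRing.injective R L))
    (IsLocalRing.specializes_closedPoint (R := R)) ha hf w hl
  exact ⟨⟨l', hl'.1, hl'.2⟩⟩

variable [∀ z : Y, IsPrincipalIdealRing (Y.presheaf.stalk z)]

lemma isFinite_toAffineLine {f : Y.functionField} {a : Γ(Y, dom f)}
    (ha : Y.presheaf.germ (dom f) (genericPoint Y) (genericPoint_mem_dom f) a = f)
    (hf : ∀ g : k[X], g ≠ 0 → g.eval₂ (constFunctionField π) f ≠ 0) :
    IsFinite (toAffineLine π a) := by
  have : IsProper (toAffineLine π a) :=
    isProper_toAffineLine π ha fun z ↦ mem_or_inv_mem_localSubring z f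
  suffices LocallyQuasiFinite (toAffineLine π a) from .of_isProper_of_locallyQuasiFinite _
  refine .of_finite_preimage_singleton _ fun w ↦ ?_
  refine Set.Finite.of_finite_image (f := (dom f).ι) ?_ (dom f).ι.injective.injOn
  by_cases hw : w.asIdeal = ⊥
  · refine (Set.finite_singleton (genericPoint Y)).subset ?_
    rintro _ ⟨z, rfl, rfl⟩
    exact eq_genericPoint_of_toAffineLine_eq π a hw
  · obtain ⟨g, hg, hg0⟩ := Submodule.exists_mem_ne_zero_of_ne_bot hw
    have hgerm := germ_eval₂ π (genericPoint_mem_dom f) a g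
    rw [ha] at hgerm
    refine (finite_setOf_notMem_localSubring (g.eval₂ (constFunctionField π) f)⁻¹).subset ?_
    rintro _ ⟨z, rfl, rfl⟩
    have := (inv_germ_mem_localSubring_iff z.2 (by rw [hgerm]; exact hf g hg0)).not.mpr
      (notMem_basicOpen_eval₂ π a hg)
    rwa [hgerm] at this

lemma isAffineOpen_dom {f : Y.functionField}
    (hf : ∀ g : k[X], g ≠ 0 → g.eval₂ (constFunctionField π) f ≠ 0) :
    IsAffineOpen (dom f) := by
  obtain ⟨a, ha⟩ := exists_section_of_le_dom (genericPoint_mem_dom f) le_rfl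
  have := isFinite_toAffineLine π ha hf
  exact isAffine_of_isAffineHom (toAffineLine π a)

lemma finite_eval₂RingHom {f : Y.functionField}
    (hf : ∀ g : k[X], g ≠ 0 → g.eval₂ (constFunctionField π) f ≠ 0) {a : Γ(Y, dom f)}
    (ha : Y.presheaf.germ (dom f) (genericPoint Y) (genericPoint_mem_dom f) a = f) :
    (eval₂RingHom (constSection π (dom f)) a).Finite := by
  have := isFinite_toAffineLine π ha hf
  have hU := isAffineOpen_dom π hf
  rw [← CommRingCat.hom_ofHom (eval₂RingHom (constSection π (dom f)) a), ← IsFinite.SpecMap_iff,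
    show Spec.map (CommRingCat.ofHom (eval₂RingHom (constSection π (dom f)) a)) =
      hU.isoSpec.inv ≫ toAffineLine π a by
    rw [toAffineLine, ← hU.isoSpec_hom, Iso.inv_hom_id_assoc]]
  infer_instance

end FiniteOverAffineLine
/-! ### Functions with a single pole -/

section SinglePole

open Polynomial

lemma exists_ne_zero_map_mem_of_forall_mem_sup {k E V : Type*} [CommRing k] [IsNoetherianRing k]
    [AddCommGroup E] [Module k E] [AddCommGroup V] [Module k V] (hE : ¬ Module.Finite k E)
    (f : E →ₗ[k] V) {W F : Submodule k V} [Module.Finite k F] (h : ∀ e, f e ∈ W ⊔ F) :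
    ∃ e ≠ 0, f e ∈ W := by
  have hF (e : E) : (W.mkQ ∘ₗ f) e ∈ F.map W.mkQ := by
    obtain ⟨w, hw, v, hv, hwv⟩ := Submodule.mem_sup.mp (h e)
    refine ⟨v, hv, ?_⟩
    rw [LinearMap.comp_apply, ← hwv, map_add, Submodule.mkQ_apply W w,
      (Submodule.Quotient.mk_eq_zero W).mpr hw, zero_add]
  have hninj : ¬ Function.Injective (W.mkQ ∘ₗ f) := fun hinj ↦
    hE (.of_injective ((W.mkQ ∘ₗ f).codRestrict _ hF) fun _ _ hab ↦ hinj congr(($hab).1))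
  rw [injective_iff_map_eq_zero] at hninj
  push Not at hninj
  obtain ⟨e, he, he0⟩ := hninj
  exact ⟨e, he0, (Submodule.Quotient.mk_eq_zero W).mp he⟩

/-- A family of valuation rings of `K` over `k` with the properties of the local rings of a proper
regular curve with function field `K`: functions have finitely many poles, and valuations have
rank one. -/
structure PlaceSystem (k K ι : Type*) [Field k] [Field K] [Algebra k K] where
  /-- The valuation rings. -/
  ring : ι → ValuationSubring K
  algebraMap_mem (z : ι) (c : k) : algebraMap k K c ∈ ring z
  finite_poles (f : K) : {z | f ∉ ring z}.Finite
  exists_pow_mul_mem {z : ι} {s : K} (hs : s⁻¹ ∉ ring z) (a : K) : ∃ N : ℕ, s ^ N * a ∈ ring z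

namespace PlaceSystem

variable {k K ι : Type*} [Field k] [Field K] [Algebra k K] (P : PlaceSystem k K ι)

/-- The rational functions which are regular at all places where `f` is. -/
def regularWhere (f : K) : Submodule k K where
  carrier := {a | ∀ z, f ∈ P.ring z → a ∈ P.ring z}
  add_mem' ha hb z hz := add_mem (ha z hz) (hb z hz)
  zero_mem' z _ := zero_mem (P.ring z)
  smul_mem' c a ha z hz := by
    rw [Algebra.smul_def]; exact mul_mem (P.algebraMap_mem z c) (ha z hz)

variable {P}

lemma inv_mem {z : ι} {x : K} (hx : x ∉ P.ring z) : x⁻¹ ∈ P.ring z :=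
  ((P.ring z).mem_or_inv_mem x).resolve_left hx

lemma aeval_mem {z : ι} {c : K} (hc : c ∈ P.ring z) (q : k[X]) : aeval c q ∈ P.ring z := by
  rw [aeval_eq_sum_range]
  refine sum_mem fun i _ ↦ ?_
  rw [Algebra.smul_def]
  exact mul_mem (P.algebraMap_mem z _) (pow_mem hc _)

lemma mem_of_aeval_mem {z : ι} {c : K} {q : k[X]} (hq : q.natDegree ≠ 0)
    (h : aeval c q ∈ P.ring z) : c ∈ P.ring z := by
  let j : k →+* P.ring z := (algebraMap k K).codRestrict (P.ring z).toSubring (P.algebraMap_mem z)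
  have : _root_.IsIntegral (P.ring z) c := isIntegral_of_isIntegral_eval₂ j hq
    (isIntegral_algebraMap (x := (⟨_, h⟩ : P.ring z)))
  obtain ⟨b, rfl⟩ := IsIntegrallyClosed.isIntegral_iff.mp this
  exact b.2

lemma exists_forall_pow_mul_mem {Z : Set ι} (hZ : Z.Finite) {s : K}
    (hs : ∀ z ∈ Z, s⁻¹ ∉ P.ring z) (a : K) :
    ∃ N : ℕ, ∀ n ≥ N, ∀ z ∈ Z, s ^ n * a ∈ P.ring z := by
  choose! N hN using fun z (hz : z ∈ Z) ↦ P.exists_pow_mul_mem (hs z hz) a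
  refine ⟨hZ.toFinset.sup N, fun n hn z hz ↦ ?_⟩
  have hNn : N z ≤ n := (Finset.le_sup (hZ.mem_toFinset.mpr hz)).trans hn
  have hsz : s ∈ P.ring z := inv_inv s ▸ inv_mem (hs z hz)
  rw [← Nat.sub_add_cancel hNn, pow_add, mul_assoc]
  exact mul_mem (pow_mem hsz _) (hN z hz)

lemma exists_forall_pow_mul_mem_regularWhere {x h : K}
    (hh : ∀ z, x ∈ P.ring z → x⁻¹ ∈ P.ring z → h ∈ P.ring z) :
    ∃ N : ℕ, ∀ n ≥ N, x ^ n * h ∈ P.regularWhere x := by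
  obtain ⟨N, hN⟩ := exists_forall_pow_mul_mem (P.finite_poles x⁻¹) (fun _ hz ↦ hz) h
  refine ⟨N, fun n hn z hz ↦ ?_⟩
  by_cases hxz : x⁻¹ ∈ P.ring z
  · exact mul_mem (pow_mem hz _) (hh z hz hxz)
  · exact hN n hn z hxz

section FiniteGeneration

variable {κ : Type*} [Fintype κ] {x : K} {t : κ → K}

/-- The finiteness of the first cohomology of the structure sheaf, computed with the two open
subsets where `x` and where `x⁻¹` is regular. -/
lemma exists_finite_sup (hx : x ≠ 0) (ht : ∀ i, t i ∈ P.regularWhere x)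
    (hgen : ∀ a ∈ P.regularWhere x, ∃ c : κ → k[X], a = ∑ i, aeval x (c i) * t i) :
    ∃ F : Submodule k K, Module.Finite k F ∧
      ∀ h : K, (∀ z, x ∈ P.ring z → x⁻¹ ∈ P.ring z → h ∈ P.ring z) →
        h ∈ P.regularWhere x ⊔ P.regularWhere x⁻¹ ⊔ F := by
  choose N hN using fun i ↦ exists_forall_pow_mul_mem_regularWhere (x := x⁻¹) (h := t i)
    fun z _ hz ↦ ht i z (inv_inv x ▸ hz)
  let M := Finset.univ.sup N
  let F : Submodule k K :=
    Submodule.span k (Set.range fun j : Fin M × κ ↦ x⁻¹ ^ (j.1 : ℕ) * t j.2)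
  have hmonomial (m n : ℕ) (i : κ) : x⁻¹ ^ m * (x ^ n * t i) ∈
      P.regularWhere x ⊔ P.regularWhere x⁻¹ ⊔ F := by
    rcases le_total m n with hmn | hnm
    · obtain ⟨d, rfl⟩ := Nat.exists_eq_add_of_le hmn
      rw [pow_add, mul_assoc, ← mul_assoc, ← mul_pow, inv_mul_cancel₀ hx, one_pow, one_mul]
      exact Submodule.mem_sup_left (Submodule.mem_sup_left fun z hz ↦
        mul_mem (pow_mem hz _) (ht i z hz))
    · obtain ⟨d, rfl⟩ := Nat.exists_eq_add_of_le' hnm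
      rw [pow_add, mul_assoc, ← mul_assoc (x⁻¹ ^ n), ← mul_pow, inv_mul_cancel₀ hx, one_pow,
        one_mul]
      rcases lt_or_ge d M with hd | hd
      · exact Submodule.mem_sup_right (Submodule.subset_span ⟨(⟨d, hd⟩, i), rfl⟩)
      · exact Submodule.mem_sup_left (Submodule.mem_sup_right
          (hN i d ((Finset.le_sup (Finset.mem_univ i)).trans hd)))
  refine ⟨F, .span_of_finite k (Set.finite_range _), fun h hh ↦ ?_⟩
  obtain ⟨m, hm⟩ := exists_forall_pow_mul_mem_regularWhere hh
  obtain ⟨c, hc⟩ := hgen _ (hm m le_rfl)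
  have hexpand : h = ∑ i, ∑ n ∈ Finset.range ((c i).natDegree + 1),
      (c i).coeff n • (x⁻¹ ^ m * (x ^ n * t i)) := by
    calc h = x⁻¹ ^ m * (x ^ m * h) := by
          rw [← mul_assoc, ← mul_pow, inv_mul_cancel₀ hx, one_pow, one_mul]
      _ = _ := by
          simp only [hc, aeval_eq_sum_range, Finset.mul_sum, Finset.sum_mul, smul_mul_assoc,
            mul_smul_comm]
  rw [hexpand]
  exact sum_mem fun i _ ↦ sum_mem fun n _ ↦ Submodule.smul_mem _ _ (hmonomial m n i)

lemma exists_notMem_and_forall_mem {y : ι} (hy : x ∉ P.ring y) {g : K}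
    (hg : g ∈ P.regularWhere x⁻¹) (hgy : g⁻¹ ∈ P.ring y)
    (hgz : ∀ z, x ∉ P.ring z → z ≠ y → g⁻¹ ∉ P.ring z) (hg0 : g ≠ 0) :
    ∃ c : K, c ∉ P.ring y ∧ ∀ z ≠ y, x⁻¹ ∈ P.ring z → c ∈ P.ring z := by
  obtain ⟨N, hN⟩ := exists_forall_pow_mul_mem (Z := {z | x ∉ P.ring z ∧ z ≠ y})
    ((P.finite_poles x).subset fun z hz ↦ hz.1) (fun z hz ↦ hgz z hz.1 hz.2) x
  refine ⟨g ^ N * x, fun h ↦ hy ?_, fun z hz hxz ↦ ?_⟩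
  · have hx : g⁻¹ ^ N * (g ^ N * x) = x := by
      rw [← mul_assoc, ← mul_pow, inv_mul_cancel₀ hg0, one_pow, one_mul]
    exact hx ▸ mul_mem (pow_mem hgy _) h
  · by_cases h : x ∈ P.ring z
    · exact mul_mem (pow_mem (hg z hxz) _) h
    · exact hN N le_rfl z ⟨h, hz⟩

lemma exists_mem_iff_ne {y : ι} (hy : x ∉ P.ring y) (ht : ∀ i, t i ∈ P.regularWhere x)
    (hgen : ∀ a ∈ P.regularWhere x, ∃ c : κ → k[X], a = ∑ i, aeval x (c i) * t i) {g : K}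
    (hg : g ∈ P.regularWhere x⁻¹) (hgy : g⁻¹ ∈ P.ring y)
    (hgz : ∀ z, x ∉ P.ring z → z ≠ y → g⁻¹ ∉ P.ring z) (hg0 : g ≠ 0) :
    ∃ a : K, ∀ z, a ∈ P.ring z ↔ z ≠ y := by
  have hx : x ≠ 0 := by rintro rfl; exact hy (zero_mem (P.ring y))
  obtain ⟨c, hcy, hcz⟩ := exists_notMem_and_forall_mem hy hg hgy hgz hg0
  obtain ⟨F, hF, hFmem⟩ := exists_finite_sup hx ht hgen
  -- The polynomials in `c` without constant term do not embed into a finite-dimensional space.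
  obtain ⟨q, hq0, hq⟩ := exists_ne_zero_map_mem_of_forall_mem_sup (Polynomial.not_finite (R := k))
    ((aeval c).toLinearMap ∘ₗ LinearMap.mulLeft k X) fun q ↦
      hFmem _ fun z hz hz' ↦ aeval_mem (hcz z (fun h ↦ hy (h ▸ hz)) hz') (X * q)
  obtain ⟨a, ha, b, hb, hab⟩ := Submodule.mem_sup.mp hq
  replace hab : a + b = aeval c (X * q) := hab
  refine ⟨a, fun z ↦ ⟨?_, fun hz ↦ ?_⟩⟩
  · rintro haz rfl
    have hdeg : (X * q).natDegree ≠ 0 := by rw [natDegree_X_mul hq0]; exact Nat.succ_ne_zero _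
    exact hcy (mem_of_aeval_mem hdeg (hab ▸ add_mem haz (hb z (inv_mem hy))))
  · by_cases hxz : x ∈ P.ring z
    · exact ha z hxz
    · rw [eq_sub_of_add_eq hab]
      exact sub_mem (aeval_mem (hcz z hz (inv_mem hxz)) _) (hb z (inv_mem hxz))

end FiniteGeneration

end PlaceSystem

end SinglePole
section ComplementOfPoint

open Polynomial

variable {k : Type u} [Field k] {Y : Scheme.{u}} [IsIntegral Y]

variable [∀ z : Y, IsPrincipalIdealRing (Y.presheaf.stalk z)]

/-- The local ring at `z` of a regular curve, as a valuation ring of the function field. -/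
noncomputable def localValuationSubring (z : Y) : ValuationSubring Y.functionField where
  __ := localSubring z
  mem_or_inv_mem' := mem_or_inv_mem_localSubring z

lemma exists_pow_mul_mem_localSubring {z : Y} {s : Y.functionField} (hs : s⁻¹ ∉ localSubring z)
    (a : Y.functionField) : ∃ N : ℕ, s ^ N * a ∈ localSubring z := by
  obtain ⟨s, rfl⟩ := (mem_or_inv_mem_localSubring z s).resolve_right hs
  obtain ⟨b, c, hc, rfl⟩ :=
    IsFractionRing.div_surjective (A := Y.presheaf.stalk z) a
  have hc0 : c ≠ 0 := nonZeroDivisors.ne_zero hc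
  have hsm : s ∈ IsLocalRing.maximalIdeal (Y.presheaf.stalk z) := fun hu ↦
    hs ⟨↑hu.unit⁻¹, eq_inv_of_mul_eq_one_right (by rw [← map_mul, hu.mul_val_inv, map_one])⟩
  have htfae := ((tfae_of_isNoetherianRing_of_isLocalRing_of_isDomain
    (Y.presheaf.stalk z)).out 0 6).mp (inferInstance : IsPrincipalIdealRing _)
  obtain ⟨n, hn⟩ := htfae (Ideal.span {c}) (by simpa using hc0)
  obtain ⟨d, hd⟩ := Ideal.mem_span_singleton.mp (hn.ge (Ideal.pow_mem_pow hsm n))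
  have hc' := (map_ne_zero_iff _
    (IsFractionRing.injective (Y.presheaf.stalk z) Y.functionField)).mpr hc0
  refine ⟨n, d * b, ?_⟩
  rw [← map_pow, hd, map_mul, map_mul]
  field_simp

variable [IsNoetherian Y]

lemma exists_generators_of_dom (π : Y ⟶ Spec (.of k)) [IsProper π] {x : Y.functionField}
    (hx : ∀ g : k[X], g ≠ 0 → g.eval₂ (constFunctionField π) x ≠ 0) :
    ∃ (n : ℕ) (t : Fin n → Y.functionField), (∀ i, dom x ≤ dom (t i)) ∧
      ∀ b, dom x ≤ dom b →
        ∃ c : Fin n → k[X], b = ∑ i, (c i).eval₂ (constFunctionField π) x * t i := by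
  obtain ⟨a, ha⟩ := exists_section_of_le_dom (genericPoint_mem_dom x) le_rfl
  have hfin := finite_eval₂RingHom π hx ha
  algebraize [eval₂RingHom (constSection π (dom x)) a]
  obtain ⟨n, s, hs⟩ := Module.Finite.exists_fin (R := k[X]) (M := Γ(Y, dom x))
  let γ := Y.presheaf.germ (dom x) (genericPoint Y) (genericPoint_mem_dom x)
  refine ⟨n, fun i ↦ γ (s i), fun i z hz ↦ germ_genericPoint_mem_localSubring (U := dom x) hz _,
    fun b hb ↦ ?_⟩
  obtain ⟨b, rfl⟩ := exists_section_of_le_dom (genericPoint_mem_dom x) hb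
  obtain ⟨c, rfl⟩ := (Submodule.mem_span_range_iff_exists_fun k[X]).mp
    (hs ▸ Submodule.mem_top : b ∈ Submodule.span k[X] (Set.range s))
  refine ⟨c, (map_sum γ.hom _ _).trans (Finset.sum_congr rfl fun i _ ↦ ?_)⟩
  have heval := germ_eval₂ π (genericPoint_mem_dom x) a (c i)
  rw [ha] at heval
  rw [← heval, Algebra.smul_def]
  exact map_mul γ.hom _ _

lemma exists_separating (π : Y ⟶ Spec (.of k)) [IsProper π] {x : Y.functionField} {y : Y}
    (hy : x ∉ localSubring y) :
    ∃ g : Y.functionField, dom x⁻¹ ≤ dom g ∧ g ≠ 0 ∧ g⁻¹ ∈ localSubring y ∧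
      ∀ z, x ∉ localSubring z → z ≠ y → g⁻¹ ∉ localSubring z := by
  have hinv {z : Y} (hz : x ∉ localSubring z) : z ∈ dom x⁻¹ :=
    (mem_or_inv_mem_localSubring z x).resolve_left hz
  have hU : IsAffineOpen (dom x⁻¹) := isAffineOpen_dom π
    fun g hg ↦ eval₂_ne_zero_of_inv_notMem_localSubring (z := y) π (by rwa [inv_inv]) hg
  let Z : Set Y := {z | x ∉ localSubring z} \ {y}
  have hZ : IsClosed Z := by
    rw [← Set.biUnion_of_singleton Z]
    refine ((finite_setOf_notMem_localSubring x).subset Set.sdiff_subset).isClosed_biUnion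
      fun z hz ↦ isClosed_singleton_of_ne_genericPoint ?_
    rintro rfl
    exact hz.1 (genericPoint_mem_dom x)
  obtain ⟨g, hgV, hyg⟩ := hU.exists_basicOpen_le (V := ⟨Zᶜ, hZ.isOpen_compl⟩)
    ⟨y, fun h ↦ h.2 rfl⟩ (hinv hy)
  have hunit : IsUnit (Y.presheaf.germ (dom x⁻¹) y (hinv hy) g) :=
    (Scheme.mem_basicOpen _ _ _ (hinv hy)).mp hyg
  have hg0 : Y.presheaf.germ (dom x⁻¹) (genericPoint Y) (genericPoint_mem_dom _) g ≠ 0 := by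
    rw [← algebraMap_germ (hinv hy)]
    exact (hunit.map _).ne_zero
  refine ⟨Y.presheaf.germ (dom x⁻¹) (genericPoint Y) (genericPoint_mem_dom _) g,
    fun z hz ↦ germ_genericPoint_mem_localSubring (U := dom x⁻¹) hz g, hg0,
    (inv_germ_mem_localSubring_iff (hinv hy) hg0).mpr hyg, fun z hz hzy h ↦ ?_⟩
  exact hgV ((inv_germ_mem_localSubring_iff (hinv hz) hg0).mp h) ⟨hz, hzy⟩

lemma isAffineOpen_of_forall_mem_iff_ne (π : Y ⟶ Spec (.of k)) [IsProper π] {y : Y}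
    (hy : ¬ IsField (Y.presheaf.stalk y)) {U : Y.Opens} (hU : ∀ z, z ∈ U ↔ z ≠ y) :
    IsAffineOpen U := by
  let : Algebra k Y.functionField := (constFunctionField π).toAlgebra
  let P : PlaceSystem k Y.functionField Y :=
    { ring := localValuationSubring
      algebraMap_mem := constFunctionField_mem π
      finite_poles := finite_setOf_notMem_localSubring
      exists_pow_mul_mem := exists_pow_mul_mem_localSubring }
  obtain ⟨x, hx⟩ : ∃ x : Y.functionField, x ∉ localSubring y := by
    by_contra! h
    exact hy (IsFractionRing.surjective_iff_isField.mp h)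
  obtain ⟨n, t, ht, hgen⟩ := exists_generators_of_dom π
    fun g hg ↦ eval₂_ne_zero_of_notMem_localSubring π hx hg
  obtain ⟨g, hg, hg0, hgy, hgz⟩ := exists_separating π hx
  obtain ⟨a, ha⟩ := PlaceSystem.exists_mem_iff_ne (P := P) hx ht hgen hg hgy hgz hg0
  have hUa : U = dom a := by
    ext z
    exact (hU z).trans (ha z).symm
  rw [hUa]
  exact isAffineOpen_dom π fun g hg ↦ eval₂_ne_zero_of_notMem_localSubring (z := y) π
    (fun h ↦ (ha y).mp h rfl) hg

lemma isAffine_complement {Y : Scheme.{u}} [IsIntegral Y] {π : Y ⟶ Spec (.of k)} [IsProper π]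
    [SmoothOfRelativeDimension 1 π] {y : Spec (.of k) ⟶ Y} (e : FormalCoordinate π y)
    (hy : y ≫ π = 𝟙 (Spec (.of k))) : IsAffine (complement π y hy : Scheme.{u}) := by
  have : IsLocallyNoetherian Y := LocallyOfFiniteType.isLocallyNoetherian π
  have : CompactSpace Y := QuasiCompact.compactSpace_of_compactSpace π
  have : IsNoetherian Y := {}
  have := isPrincipalIdealRing_stalk π
  refine isAffineOpen_of_forall_mem_iff_ne π (y := point y) (fun hfield ↦ ?_) fun z ↦ Iff.rfl
  obtain ⟨a, ha, ha'⟩ := e.exists_expand_ne_zero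
  rw [(IsLocalRing.isField_iff_maximalIdeal_eq).mp hfield] at ha
  exact ha' (by rw [(Submodule.mem_bot _).mp ha, map_zero])

end ComplementOfPoint
/-! ### Čech cocycles -/

section Cocycles

variable {S' S : Scheme.{u}} {f : S' ⟶ S} {𝒰 𝒱 : EtaleCover S} {𝒲 : EtaleCover S'}
  {G H : Type*} [Group G] [Group H]

namespace Cocycle

/-- The value at the point `t` of a cocycle, evaluated on the `S`-morphisms `a` and `b`. -/
def val (γ : Cocycle G 𝒰) {i j : 𝒰.I₀} {T : Over S} (a : T ⟶ Over.mk (𝒰.f i))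
    (b : T ⟶ Over.mk (𝒰.f j)) (t : T.left) : G :=
  DFunLike.coe (F := LocallyConstant T.left G) (γ.ev i j a b) t

lemma isLocallyConstant_val (γ : Cocycle G 𝒰) {i j : 𝒰.I₀} {T : Over S}
    (a : T ⟶ Over.mk (𝒰.f i)) (b : T ⟶ Over.mk (𝒰.f j)) :
    IsLocallyConstant (fun t : T.left ↦ γ.val a b t) :=
  LocallyConstant.isLocallyConstant (X := T.left) (Y := G) (γ.ev i j a b)

lemma val_trans (γ : Cocycle G 𝒰) {i j l : 𝒰.I₀} {T : Over S} (a : T ⟶ Over.mk (𝒰.f i))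
    (b : T ⟶ Over.mk (𝒰.f j)) (c : T ⟶ Over.mk (𝒰.f l)) (t : T.left) :
    γ.val a b t * γ.val b c t = γ.val a c t :=
  congrArg (fun h : LocallyConstant T.left G ↦ h t) (γ.ev_trans i j l a b c)

lemma val_precomp (γ : Cocycle G 𝒰) {i j : 𝒰.I₀} {T T' : Over S} (φ : T ⟶ T')
    (a : T' ⟶ Over.mk (𝒰.f i)) (b : T' ⟶ Over.mk (𝒰.f j)) (t : T.left) :
    γ.val (φ ≫ a) (φ ≫ b) t = γ.val a b (φ.left t) :=
  (congrArg (fun h : LocallyConstant T.left G ↦ h t) (γ.ev_precomp i j φ a b)).symm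

lemma ext_val {γ δ : Cocycle G 𝒰} (h : ∀ (i j : 𝒰.I₀) {T : Over S} (a : T ⟶ Over.mk (𝒰.f i))
    (b : T ⟶ Over.mk (𝒰.f j)) (t : T.left), γ.val a b t = δ.val a b t) : γ = δ := by
  have hcochain : γ.toOneCochain = δ.toOneCochain := by
    refine OneCochain.ext ?_
    funext i j T a b
    exact LocallyConstant.ext (X := T.left) (Y := G) fun t ↦ h i j a b t
  cases γ
  cases δ
  cases hcochain
  rfl

/-- The cocycle with the values `v` at points. -/
def ofVal (v : ∀ (i j : 𝒰.I₀) {T : Over S} (_ : T ⟶ Over.mk (𝒰.f i))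
      (_ : T ⟶ Over.mk (𝒰.f j)) (_ : T.left), G)
    (hv : ∀ (i j : 𝒰.I₀) {T : Over S} (a : T ⟶ Over.mk (𝒰.f i)) (b : T ⟶ Over.mk (𝒰.f j)),
      IsLocallyConstant (v i j a b))
    (hp : ∀ (i j : 𝒰.I₀) {T T' : Over S} (φ : T ⟶ T') (a : T' ⟶ Over.mk (𝒰.f i))
      (b : T' ⟶ Over.mk (𝒰.f j)) (t : T.left), v i j a b (φ.left t) = v i j (φ ≫ a) (φ ≫ b) t)
    (ht : ∀ (i j l : 𝒰.I₀) {T : Over S} (a : T ⟶ Over.mk (𝒰.f i)) (b : T ⟶ Over.mk (𝒰.f j))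
      (c : T ⟶ Over.mk (𝒰.f l)) (t : T.left), v i j a b t * v j l b c t = v i l a c t) :
    Cocycle G 𝒰 where
  ev i j T a b := (⟨v i j a b, hv i j a b⟩ : LocallyConstant T.left G)
  ev_precomp i j T _ φ a b := LocallyConstant.ext (X := T.left) (Y := G) (hp i j φ a b)
  ev_trans i j l T a b c := LocallyConstant.ext (X := T.left) (Y := G) (ht i j l a b c)

/-- The image of a cocycle under a homomorphism. -/
def map (γ : Cocycle G 𝒰) (χ : G →* H) : Cocycle H 𝒰 :=
  .ofVal (fun _ _ _ a b t ↦ χ (γ.val a b t))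
    (fun _ _ _ a b ↦ (γ.isLocallyConstant_val a b).comp χ)
    (fun _ _ _ _ φ a b t ↦ by rw [γ.val_precomp])
    (fun _ _ _ _ a b c t ↦ by rw [← map_mul, γ.val_trans])

/-- The product of two cocycles. -/
def prod (γ : Cocycle G 𝒰) (δ : Cocycle H 𝒰) : Cocycle (G × H) 𝒰 :=
  .ofVal (fun _ _ _ a b t ↦ (γ.val a b t, δ.val a b t))
    (fun _ _ _ a b ↦ (γ.isLocallyConstant_val a b).prodMk (δ.isLocallyConstant_val a b))
    (fun _ _ _ _ φ a b t ↦ by rw [γ.val_precomp, δ.val_precomp])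
    (fun _ _ _ _ a b c t ↦ by rw [Prod.mk_mul_mk, γ.val_trans, δ.val_trans])

lemma exists_map_subtype_eq (γ : Cocycle G 𝒰) (N : Subgroup G)
    (h : ∀ (i j : 𝒰.I₀) {T : Over S} (a : T ⟶ Over.mk (𝒰.f i)) (b : T ⟶ Over.mk (𝒰.f j))
      (t : T.left), γ.val a b t ∈ N) : ∃ δ : Cocycle N 𝒰, δ.map N.subtype = γ :=
  ⟨.ofVal (fun i j _ a b t ↦ ⟨γ.val a b t, h i j a b t⟩)
    (fun _ _ _ a b ↦ IsLocallyConstant.desc _ Subtype.val (γ.isLocallyConstant_val a b)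
      Subtype.val_injective)
    (fun _ _ _ _ φ a b t ↦ Subtype.ext (γ.val_precomp φ a b t).symm)
    (fun _ _ _ _ a b c t ↦ Subtype.ext (γ.val_trans a b c t)),
    ext_val fun _ _ _ _ _ _ ↦ rfl⟩

lemma isCohomologous_iff (γ δ : Cocycle G 𝒰) : γ.IsCohomologous δ ↔
    ∃ α : ∀ i, LocallyConstant (𝒰.X i) G, ∀ (i j : 𝒰.I₀) {T : Over S}
      (a : T ⟶ Over.mk (𝒰.f i)) (b : T ⟶ Over.mk (𝒰.f j)) (t : T.left),
      α i (a.left t) * γ.val a b t = δ.val a b t * α j (b.left t) := by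
  constructor
  · rintro ⟨α, h⟩
    exact ⟨α, fun i j T a b t ↦ congrArg (fun h : LocallyConstant T.left G ↦ h t) (h i j a b)⟩
  · rintro ⟨α, h⟩
    exact ⟨α, fun i j T a b ↦ LocallyConstant.ext (X := T.left) (Y := G) (h i j a b)⟩

lemma isCohomologous_trans {γ δ ε : Cocycle G 𝒰} (h : γ.IsCohomologous δ)
    (h' : δ.IsCohomologous ε) : γ.IsCohomologous ε :=
  (OneCocycle.equivalence_isCohomologous _ _).trans h h'

lemma isCohomologous_symm {γ δ : Cocycle G 𝒰} (h : γ.IsCohomologous δ) : δ.IsCohomologous γ :=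
  (OneCocycle.equivalence_isCohomologous _ _).symm h

lemma isCohomologous_map {γ δ : Cocycle G 𝒰} (χ : G →* H) (h : γ.IsCohomologous δ) :
    (γ.map χ).IsCohomologous (δ.map χ) := by
  obtain ⟨α, hα⟩ := (isCohomologous_iff _ _).mp h
  refine (isCohomologous_iff _ _).mpr ⟨fun i ↦ (α i).map χ, fun i j T a b t ↦ ?_⟩
  have := congrArg χ (hα i j a b t)
  rwa [map_mul, map_mul] at this

lemma exists_twist (γ : Cocycle G 𝒰) (α : ∀ i, LocallyConstant (𝒰.X i) G) :
    ∃ δ : Cocycle G 𝒰, γ.IsCohomologous δ ∧ ∀ (i j : 𝒰.I₀) {T : Over S}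
      (a : T ⟶ Over.mk (𝒰.f i)) (b : T ⟶ Over.mk (𝒰.f j)) (t : T.left),
      δ.val a b t = α i (a.left t) * γ.val a b t * (α j (b.left t))⁻¹ := by
  let δ : Cocycle G 𝒰 := .ofVal
    (fun i j _ a b t ↦ α i (a.left t) * γ.val a b t * (α j (b.left t))⁻¹)
    (fun i j _ a b ↦ (((α i).comap a.left.base.hom).isLocallyConstant.mul
      (γ.isLocallyConstant_val a b)).mul ((α j).comap b.left.base.hom).isLocallyConstant.inv)
    (fun _ _ _ _ φ a b t ↦ by rw [γ.val_precomp]; rfl)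
    (fun _ _ _ _ a b c t ↦ by rw [← γ.val_trans a b c]; group)
  have hδ (i j : 𝒰.I₀) {T : Over S} (a : T ⟶ Over.mk (𝒰.f i)) (b : T ⟶ Over.mk (𝒰.f j))
      (t : T.left) : δ.val a b t = α i (a.left t) * γ.val a b t * (α j (b.left t))⁻¹ := rfl
  exact ⟨δ, (isCohomologous_iff _ _).mpr ⟨α, fun i j T a b t ↦ by simp [hδ]⟩, hδ⟩

lemma exists_isCohomologous_map_subtype_ker {χ : G →* H} (hχ : Function.Surjective χ)
    {γ : Cocycle G 𝒰} (h : (γ.map χ).IsCohomologous 1) :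
    ∃ δ : Cocycle χ.ker 𝒰, γ.IsCohomologous (δ.map χ.ker.subtype) := by
  obtain ⟨α, hα⟩ := (isCohomologous_iff _ _).mp h
  obtain ⟨γ', hγγ', hγ'⟩ := γ.exists_twist fun i ↦ (α i).map (Function.surjInv hχ)
  obtain ⟨δ, rfl⟩ := γ'.exists_map_subtype_eq χ.ker fun i j T a b t ↦ by
    have hαt : α i (a.left t) * χ (γ.val a b t) = 1 * α j (b.left t) := hα i j a b t
    rw [MonoidHom.mem_ker, hγ', map_mul, map_mul, map_inv, mul_inv_eq_one,
      LocallyConstant.map_apply, LocallyConstant.map_apply, Function.comp_apply,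
      Function.comp_apply, Function.surjInv_eq hχ, Function.surjInv_eq hχ, hαt, one_mul]
  exact ⟨δ, hγγ'⟩

lemma isCohomologous_of_map_central {χ : H →* G} (hχ : Function.Injective χ)
    (hcen : ∀ c g, χ c * g = g * χ c) {γ δ : Cocycle H 𝒰}
    (h : (γ.map χ).IsCohomologous (δ.map χ)) : γ.IsCohomologous δ := by
  obtain ⟨α, hα⟩ := (isCohomologous_iff _ _).mp h
  -- A set-theoretic section `s` of `G → G ⧸ H` decomposes `α` as `s α * χ (ρ α)`.
  let s (g : G) : G := Function.surjInv (QuotientGroup.mk_surjective (s := χ.range)) g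
  have hs (g : G) : ∃ c, χ c = (s g)⁻¹ * g :=
    QuotientGroup.eq.mp (Function.surjInv_eq (QuotientGroup.mk_surjective (s := χ.range)) g)
  choose ρ hρ using hs
  have hsχ (g : G) (c : H) : s (g * χ c) = s g := by
    have : ((g * χ c : G) : G ⧸ χ.range) = g :=
      (QuotientGroup.eq (s := χ.range).mpr ⟨c, by simp⟩).symm
    simp only [s, this]
  refine (isCohomologous_iff _ _).mpr ⟨fun i ↦ (α i).map ρ, fun i j T a b t ↦ hχ ?_⟩
  have hαt : α i (a.left t) * χ (γ.val a b t) = χ (δ.val a b t) * α j (b.left t) := hα i j a b t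
  have hst : s (α i (a.left t)) = s (α j (b.left t)) := by
    rw [← hsχ _ (γ.val a b t), hαt, hcen, hsχ]
  rw [map_mul, map_mul, LocallyConstant.map_apply, LocallyConstant.map_apply, Function.comp_apply,
    Function.comp_apply, hρ, hρ, hst, mul_assoc, hαt, ← mul_assoc, ← hcen, mul_assoc]

end Cocycle

namespace CoverMap

/-- The identity of a covering. -/
def refl (𝒰 : EtaleCover S) : CoverMap (𝟙 S) 𝒰 𝒰 := ⟨id, fun _ ↦ 𝟙 _, fun _ ↦ by simp⟩

lemma refl_pullbackCocycle (γ : Cocycle G 𝒰) : (refl 𝒰).pullbackCocycle γ = γ := by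
  refine Cocycle.ext_val fun i j T a b t ↦ ?_
  let φ : T ⟶ (Over.map (𝟙 S)).obj T := Over.homMk (𝟙 _) (by simp)
  have h := γ.val_precomp φ ((refl 𝒰).push a) ((refl 𝒰).push b) t
  have ha : φ ≫ (refl 𝒰).push a = a := by ext; simp [φ, push, refl]
  have hb : φ ≫ (refl 𝒰).push b = b := by ext; simp [φ, push, refl]
  rw [ha, hb] at h
  exact h.symm

lemma isCohomologous_pullback_pullback {S₁ S₂ S₃ : Scheme.{u}} {𝒲 : EtaleCover S₃}
    {𝒱₁ : EtaleCover S₁} {𝒱₂ : EtaleCover S₂} {g₁ : S₃ ⟶ S₁} {f₁ : S₁ ⟶ S} {g₂ : S₃ ⟶ S₂}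
    {f₂ : S₂ ⟶ S} (n₁ : CoverMap g₁ 𝒲 𝒱₁) (m₁ : CoverMap f₁ 𝒱₁ 𝒰) (n₂ : CoverMap g₂ 𝒲 𝒱₂)
    (m₂ : CoverMap f₂ 𝒱₂ 𝒰) (h : g₁ ≫ f₁ = g₂ ≫ f₂) (γ : Cocycle G 𝒰) :
    (n₁.pullbackCocycle (m₁.pullbackCocycle γ)).IsCohomologous
      (n₂.pullbackCocycle (m₂.pullbackCocycle γ)) := by
  rw [← pullbackCocycle_comp, ← pullbackCocycle_comp, ← pullbackCocycle_cast _ h]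
  exact isCohomologous_of_maps _ _ γ

lemma exists_lift (m : CoverMap f 𝒲 𝒰) (q : CoverMap (𝟙 S) 𝒱 𝒰) :
    ∃ (𝒲' : EtaleCover S') (r : CoverMap (𝟙 S') 𝒲' 𝒲) (m' : CoverMap f 𝒲' 𝒱),
      ∀ {G : Type w} [Group G] (γ : Cocycle G 𝒰),
        (r.pullbackCocycle (m.pullbackCocycle γ)).IsCohomologous
          (m'.pullbackCocycle (q.pullbackCocycle γ)) :=
  ⟨interCover 𝒲 (pullbackCover f 𝒱), interFst _ _,
    ((interSnd _ _).comp (ofPullback f 𝒱)).cast (Category.id_comp f), fun γ ↦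
      isCohomologous_pullback_pullback _ m _ q (by rw [Category.id_comp, Category.comp_id]) γ⟩

end CoverMap

namespace H1

/-- The class of a cocycle. -/
def mk (𝒰 : EtaleCover S) (γ : Cocycle G 𝒰) : H1 S G :=
  Quotient.mk (cechSetoid S G) ⟨𝒰, γ⟩

lemma mk_eq_mk_iff {γ : Cocycle G 𝒰} {δ : Cocycle G 𝒱} : mk 𝒰 γ = mk 𝒱 δ ↔
    ∃ (𝒲 : EtaleCover S) (m : CoverMap (𝟙 S) 𝒲 𝒰) (n : CoverMap (𝟙 S) 𝒲 𝒱),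
      (m.pullbackCocycle γ).IsCohomologous (n.pullbackCocycle δ) :=
  Quotient.eq (r := cechSetoid S G)

lemma mk_eq_mk_iff_of_cover {γ δ : Cocycle G 𝒰} : mk 𝒰 γ = mk 𝒰 δ ↔
    ∃ (𝒱 : EtaleCover S) (n : CoverMap (𝟙 S) 𝒱 𝒰),
      (n.pullbackCocycle γ).IsCohomologous (n.pullbackCocycle δ) := by
  rw [mk_eq_mk_iff]
  constructor
  · rintro ⟨𝒱, n, n', h⟩
    exact ⟨𝒱, n, Cocycle.isCohomologous_trans h (CoverMap.isCohomologous_of_maps _ _ _)⟩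
  · rintro ⟨𝒱, n, h⟩
    exact ⟨𝒱, n, n, h⟩

lemma mk_pullbackCocycle (m : CoverMap (𝟙 S) 𝒱 𝒰) (γ : Cocycle G 𝒰) :
    mk 𝒱 (m.pullbackCocycle γ) = mk 𝒰 γ := by
  refine mk_eq_mk_iff.mpr ⟨𝒱, .refl 𝒱, m, ?_⟩
  rw [CoverMap.refl_pullbackCocycle]
  exact (OneCocycle.equivalence_isCohomologous _ _).refl _

lemma exists_eq_mk_and_eq_mk (x y : H1 S G) :
    ∃ (𝒰 : EtaleCover S) (γ δ : Cocycle G 𝒰), x = mk 𝒰 γ ∧ y = mk 𝒰 δ := by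
  induction x using Quotient.inductionOn with | _ x
  induction y using Quotient.inductionOn with | _ y
  exact ⟨interCover x.1 y.1, (CoverMap.interFst _ _).pullbackCocycle x.2,
    (CoverMap.interSnd _ _).pullbackCocycle y.2, (mk_pullbackCocycle _ x.2).symm,
    (mk_pullbackCocycle _ y.2).symm⟩

lemma pullback_mk (m : CoverMap f 𝒲 𝒰) (γ : Cocycle G 𝒰) :
    H1.pullback f G (mk 𝒰 γ) = mk 𝒲 (m.pullbackCocycle γ) := by
  let n : CoverMap (𝟙 S') 𝒲 (pullbackCover f 𝒰) :=
    ⟨m.idx, fun i ↦ Limits.pullback.lift (𝒲.f i) (m.hom i) (m.comm i).symm,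
      fun i ↦ (Limits.pullback.lift_fst _ _ _).trans (Category.comp_id _).symm⟩
  refine mk_eq_mk_iff.mpr ⟨𝒲, n, .refl 𝒲, ?_⟩
  rw [CoverMap.refl_pullbackCocycle, ← CoverMap.pullbackCocycle_comp,
    ← CoverMap.pullbackCocycle_cast _ (Category.id_comp f)]
  exact CoverMap.isCohomologous_of_maps _ _ _

lemma pullback_injective_iff : Function.Injective (H1.pullback f G) ↔
    ∀ (𝒰 : EtaleCover S) (𝒲 : EtaleCover S') (m : CoverMap f 𝒲 𝒰) (γ δ : Cocycle G 𝒰),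
      (m.pullbackCocycle γ).IsCohomologous (m.pullbackCocycle δ) →
      ∃ (𝒱 : EtaleCover S) (n : CoverMap (𝟙 S) 𝒱 𝒰),
        (n.pullbackCocycle γ).IsCohomologous (n.pullbackCocycle δ) := by
  refine ⟨fun hinj 𝒰 𝒲 m γ δ h ↦ mk_eq_mk_iff_of_cover.mp (hinj ?_), fun H x y hxy ↦ ?_⟩
  · rw [pullback_mk m, pullback_mk m]
    exact mk_eq_mk_iff_of_cover.mpr ⟨𝒲, .refl 𝒲, (CoverMap.refl 𝒲).isCohomologous_pullback h⟩
  · obtain ⟨𝒰, γ, δ, rfl, rfl⟩ := exists_eq_mk_and_eq_mk x y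
    let m := CoverMap.ofPullback f 𝒰
    rw [pullback_mk m, pullback_mk m] at hxy
    obtain ⟨𝒲, n, hn⟩ := mk_eq_mk_iff_of_cover.mp hxy
    refine mk_eq_mk_iff_of_cover.mpr (H 𝒰 𝒲 ((n.comp m).cast (Category.id_comp f)) γ δ ?_)
    rwa [CoverMap.pullbackCocycle_cast, CoverMap.pullbackCocycle_cast,
      CoverMap.pullbackCocycle_comp, CoverMap.pullbackCocycle_comp]

end H1

end Cocycles
/-! ### Twists of sets with an action of a `p`-group -/

section PGroups

variable {G : Type*} [Group G]

lemma exists_smul_eq_of_stabilizer_le_ker {A X : Type*} [Group A] [MulAction G X] {x : X}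
    {χ : G →* A} (h : MulAction.stabilizer G x ≤ χ.ker) :
    ∃ r : X → A, ∀ g : G, r (g • x) = χ g := by
  have hfactors : Function.FactorsThrough χ (fun g : G ↦ g • x) := fun g g' hgg' ↦ by
    have hmem : g'⁻¹ * g ∈ MulAction.stabilizer G x := by
      rw [MulAction.mem_stabilizer_iff, mul_smul, inv_smul_eq_iff]
      exact hgg'
    rw [eq_comm, ← inv_mul_eq_one, ← map_inv, ← map_mul]
    exact h hmem
  exact ⟨Function.extend (fun g : G ↦ g • x) χ 1, fun g ↦ hfactors.extend_apply 1 g⟩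

variable [Finite G] {p : ℕ} [Fact p.Prime]

lemma exists_normal_index_eq_prime (hG : IsPGroup p G) {H : Subgroup G} (hH : H ≠ ⊤) :
    ∃ N : Subgroup G, N.Normal ∧ H ≤ N ∧ N.index = p := by
  have hp : p.Prime := Fact.out
  obtain ⟨m, hm⟩ := IsPGroup.iff_card.mp (hG.to_subgroup H)
  obtain ⟨_ | k, hk⟩ := hG.index H
  · exact absurd (H.index_eq_one.mp (hk.trans (pow_zero p))) hH
  have hcard : Nat.card G = p ^ (m + k) * p := by
    rw [← H.card_mul_index, hm, hk, ← pow_add, ← pow_succ, add_assoc]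
  obtain ⟨N, hN, hHN⟩ := Sylow.exists_subgroup_card_pow_prime_le p (m := m + k)
    (by rw [hcard]; exact dvd_mul_right _ _) H hm (Nat.le_add_right m k)
  have hindex : N.index = p :=
    Nat.eq_of_mul_eq_mul_left (pow_pos hp.pos _) (by rw [← hN, N.card_mul_index, hN, hcard])
  refine ⟨N, Subgroup.normal_of_index_eq_minFac_card ?_, hHN, hindex⟩
  rw [hindex, hcard, ← pow_succ, hp.pow_minFac (Nat.succ_ne_zero _)]

lemma exists_surjective_zmod_le_ker (hG : IsPGroup p G) {H : Subgroup G} (hH : H ≠ ⊤) :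
    ∃ χ : G →* Multiplicative (ZMod p), Function.Surjective χ ∧ H ≤ χ.ker := by
  obtain ⟨N, _, hHN, hindex⟩ := exists_normal_index_eq_prime hG hH
  let ε : G ⧸ N ≃* Multiplicative (ZMod p) :=
    mulEquivOfPrimeCardEq (p := p) (N.index_eq_card ▸ hindex) (by simp)
  exact ⟨ε.toMonoidHom.comp (QuotientGroup.mk' N),
    ε.surjective.comp (QuotientGroup.mk'_surjective N), fun x hx ↦ by simpa using hHN hx⟩

lemma exists_injective_central_zmod [Nontrivial G] (hG : IsPGroup p G) :
    ∃ j : Multiplicative (ZMod p) →* G, Function.Injective j ∧ ∀ c g, j c * g = g * j c := by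
  have := hG.center_nontrivial
  have hdvd : p ∣ Nat.card (Subgroup.center G) :=
    (hG.to_subgroup (Subgroup.center G)).card_eq_or_dvd.resolve_left Finite.one_lt_card.ne'
  obtain ⟨z, hz⟩ := exists_prime_orderOf_dvd_card' p hdvd
  let ε : Multiplicative (ZMod p) ≃* Subgroup.zpowers z :=
    mulEquivOfPrimeCardEq (p := p) (by simp) (by rw [Nat.card_zpowers, hz])
  exact ⟨(Subgroup.center G).subtype.comp ((Subgroup.zpowers z).subtype.comp ε.toMonoidHom),
    Subtype.val_injective.comp (Subtype.val_injective.comp ε.injective),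
    fun c g ↦ (Subgroup.mem_center_iff.mp (ε c).1.2 g).symm⟩

end PGroups

section TwistedSections

variable {S' S : Scheme.{u}} {f : S' ⟶ S} {𝒰 : EtaleCover S} {𝒲 : EtaleCover S'}
  {G : Type*} [Group G] {X : Type*} [MulAction G X]

/-- The family `σ` is a global section of the twist of the constant sheaf `X` by the cocycle `γ`. -/
def IsTwistedSection (γ : Cocycle G 𝒰) (σ : ∀ i, LocallyConstant (𝒰.X i) X) : Prop :=
  ∀ (i j : 𝒰.I₀) {T : Over S} (a : T ⟶ Over.mk (𝒰.f i)) (b : T ⟶ Over.mk (𝒰.f j)) (t : T.left),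
    γ.val a b t • σ j (b.left t) = σ i (a.left t)

variable (X) in
/-- The twist of the constant sheaf `X` by the cocycle `γ` has a global section. -/
def HasTwistedSection (γ : Cocycle G 𝒰) : Prop :=
  ∃ σ : ∀ i, LocallyConstant (𝒰.X i) X, IsTwistedSection γ σ

lemma HasTwistedSection.of_isCohomologous {γ δ : Cocycle G 𝒰} (h : γ.IsCohomologous δ)
    (hγ : HasTwistedSection X γ) : HasTwistedSection X δ := by
  obtain ⟨α, hα⟩ := (Cocycle.isCohomologous_iff γ δ).mp h
  obtain ⟨σ, hσ⟩ := hγ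
  let τ (i : 𝒰.I₀) : LocallyConstant (𝒰.X i) X :=
    ⟨fun t ↦ α i t • σ i t, ((α i).isLocallyConstant.prodMk (σ i).isLocallyConstant).comp
      fun z : G × X ↦ z.1 • z.2⟩
  refine ⟨τ, fun i j T a b t ↦ ?_⟩
  change δ.val a b t • α j (b.left t) • σ j (b.left t) = α i (a.left t) • σ i (a.left t)
  rw [smul_smul, ← hα i j a b t, ← smul_smul, hσ]

lemma HasTwistedSection.pullback (m : CoverMap f 𝒲 𝒰) {γ : Cocycle G 𝒰}
    (hγ : HasTwistedSection X γ) : HasTwistedSection X (m.pullbackCocycle γ) := by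
  obtain ⟨σ, hσ⟩ := hγ
  exact ⟨fun i ↦ (σ (m.idx i)).comap (m.hom i).base.hom,
    fun i j T a b t ↦ hσ _ _ (m.push a) (m.push b) t⟩

namespace IsTwistedSection

variable {γ : Cocycle G 𝒰} {σ : ∀ i, LocallyConstant (𝒰.X i) X}

lemma mem_orbit_of_eq (hσ : IsTwistedSection γ σ) {i j : 𝒰.I₀} {w : 𝒰.X i} {w' : 𝒰.X j}
    (h : 𝒰.f i w = 𝒰.f j w') : σ i w ∈ MulAction.orbit G (σ j w') := by
  obtain ⟨t, rfl, rfl⟩ := Scheme.Pullback.exists_preimage_pullback w w' h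
  let T : Over S := Over.mk (pullback.fst (𝒰.f i) (𝒰.f j) ≫ 𝒰.f i)
  let a : T ⟶ Over.mk (𝒰.f i) := Over.homMk (pullback.fst (𝒰.f i) (𝒰.f j))
  let b : T ⟶ Over.mk (𝒰.f j) := Over.homMk (pullback.snd (𝒰.f i) (𝒰.f j))
    pullback.condition.symm
  exact ⟨γ.val a b t, hσ i j a b t⟩

lemma mem_orbit [PreconnectedSpace S] (hσ : IsTwistedSection γ σ) {i j : 𝒰.I₀} (w : 𝒰.X i)
    (w' : 𝒰.X j) : σ i w ∈ MulAction.orbit G (σ j w') := by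
  let U (Z : Set X) : Set S := ⋃ l, 𝒰.f l '' (σ l ⁻¹' Z)
  have hU (Z : Set X) : IsOpen (U Z) := isOpen_iUnion fun l ↦
    have := 𝒰.etale l
    (𝒰.f l).isOpenMap _ ((σ l).isLocallyConstant Z)
  let Z : Set X := MulAction.orbit G (σ j w')
  have hmem {l : 𝒰.I₀} {v : 𝒰.X l} : 𝒰.f l v ∈ U Z ↔ σ l v ∈ Z := by
    refine ⟨fun h ↦ ?_, fun h ↦ Set.mem_iUnion.mpr ⟨l, v, h, rfl⟩⟩
    obtain ⟨l', v', hv', heq⟩ := Set.mem_iUnion.mp h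
    have horb : MulAction.orbit G (σ l' v') = Z := MulAction.orbit_eq_iff.mpr hv'
    rw [← horb]
    exact hσ.mem_orbit_of_eq heq.symm
  have hcompl : (U Z)ᶜ = U Zᶜ := by
    ext s
    obtain ⟨l, v, rfl⟩ := 𝒰.exists_eq s
    refine ⟨fun h ↦ Set.mem_iUnion.mpr ⟨l, v, fun hv ↦ h (hmem.mpr hv), rfl⟩, fun h hs ↦ ?_⟩
    obtain ⟨l', v', hv', heq⟩ := Set.mem_iUnion.mp h
    exact hv' (hmem.mp (heq ▸ hs))
  have huniv : U Z = Set.univ := IsClopen.eq_univ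
    ⟨⟨hcompl ▸ hU Zᶜ⟩, hU Z⟩ ⟨𝒰.f j w', hmem.mpr (MulAction.mem_orbit_self _)⟩
  exact hmem.mp (huniv ▸ Set.mem_univ _)

lemma isCohomologous_one_map [PreconnectedSpace S] (hσ : IsTwistedSection γ σ) {A : Type*}
    [Group A] {χ : G →* A} {i₀ : 𝒰.I₀} (w₀ : 𝒰.X i₀)
    (h : MulAction.stabilizer G (σ i₀ w₀) ≤ χ.ker) :
    (1 : Cocycle A 𝒰).IsCohomologous (γ.map χ) := by
  obtain ⟨r, hr⟩ := exists_smul_eq_of_stabilizer_le_ker h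
  refine (Cocycle.isCohomologous_iff _ _).mpr ⟨fun i ↦ (σ i).map r, fun i j T a b t ↦ ?_⟩
  change r (σ i (a.left t)) * 1 = χ (γ.val a b t) * r (σ j (b.left t))
  obtain ⟨g, hg⟩ := hσ.mem_orbit (b.left t) w₀
  have hg : g • σ i₀ w₀ = σ j (b.left t) := hg
  rw [mul_one, ← hσ i j a b t, ← hg, smul_smul, hr, hr, map_mul]

end IsTwistedSection

/-- If the stabilizer of a value of the section is all of `G`, that value is a global section over
the base. Otherwise the section reduces the structure group to the kernel of a surjection to
`ℤ/p`, after pulling back and hence, by injectivity, already on the base. -/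
lemma HasTwistedSection.exists_refinement {p : ℕ} [Fact p.Prime] [ConnectedSpace S']
    (hf : Function.Injective (H1.pullback f (Multiplicative (ZMod p)))) {G : Type w} [Group G]
    [Finite G] [MulAction G X] (hG : IsPGroup p G) (m : CoverMap f 𝒲 𝒰) (γ : Cocycle G 𝒰)
    (hγ : HasTwistedSection X (m.pullbackCocycle γ)) :
    ∃ (𝒱 : EtaleCover S) (n : CoverMap (𝟙 S) 𝒱 𝒰), HasTwistedSection X (n.pullbackCocycle γ) := by
  induction hcard : Nat.card G using Nat.strong_induction_on generalizing G 𝒰 𝒲 with | _ N IH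
  obtain ⟨σ, hσ⟩ := id hγ
  obtain ⟨i₀, w₀, -⟩ := 𝒲.exists_eq (Classical.arbitrary S')
  by_cases hstab : MulAction.stabilizer G (σ i₀ w₀) = ⊤
  · refine ⟨𝒰, .refl 𝒰, fun _ ↦ LocallyConstant.const _ (σ i₀ w₀), fun i j T a b t ↦ ?_⟩
    exact MulAction.mem_stabilizer_iff.mp (hstab ▸ Subgroup.mem_top _)
  obtain ⟨χ, hχ, hker⟩ := exists_surjective_zmod_le_ker hG hstab
  obtain ⟨𝒱, q, hq⟩ := H1.pullback_injective_iff.mp hf _ _ m 1 (γ.map χ)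
    (hσ.isCohomologous_one_map w₀ hker)
  obtain ⟨δ, hδ⟩ := (q.pullbackCocycle γ).exists_isCohomologous_map_subtype_ker hχ
    (Cocycle.isCohomologous_symm hq)
  obtain ⟨𝒲', r, m', hm'⟩ := m.exists_lift q
  have hδ' : HasTwistedSection X (m'.pullbackCocycle (δ.map χ.ker.subtype)) :=
    ((hγ.pullback r).of_isCohomologous (hm' γ)).of_isCohomologous (m'.isCohomologous_pullback hδ)
  have hlt : Nat.card χ.ker < N := by
    refine hcard ▸ lt_of_le_of_ne (Subgroup.card_le_card_group _) fun h ↦ ?_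
    obtain ⟨g, hg⟩ := hχ (Multiplicative.ofAdd 1)
    have hg1 : χ g = 1 := (Subgroup.eq_top_of_card_eq _ h).ge (Subgroup.mem_top g)
    exact one_ne_zero (α := ZMod p) (hg.symm.trans hg1)
  obtain ⟨𝒱', q', h'⟩ := IH _ hlt (hG.to_subgroup χ.ker) m' δ hδ' rfl
  have hγ' : HasTwistedSection X (q'.pullbackCocycle (q.pullbackCocycle γ)) :=
    HasTwistedSection.of_isCohomologous
      (Cocycle.isCohomologous_symm (q'.isCohomologous_pullback hδ)) h'
  refine ⟨𝒱', (q'.comp q).cast (Category.comp_id _), ?_⟩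
  rwa [CoverMap.pullbackCocycle_cast, CoverMap.pullbackCocycle_comp]

/-- The action of `G × G` on `G` by left and right multiplication, whose twisted sections are the
isomorphisms of torsors. -/
abbrev biMulAction (G : Type*) [Group G] : MulAction (G × G) G where
  smul g x := g.1 * x * g.2⁻¹
  one_smul x := by change 1 * x * 1⁻¹ = x; simp
  mul_smul g h x := by
    change g.1 * h.1 * x * (g.2 * h.2)⁻¹ = g.1 * (h.1 * x * h.2⁻¹) * g.2⁻¹
    group

attribute [local instance] biMulAction in
lemma hasTwistedSection_prod_iff (γ δ : Cocycle G 𝒰) :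
    HasTwistedSection G (γ.prod δ) ↔ δ.IsCohomologous γ := by
  rw [Cocycle.isCohomologous_iff]
  refine exists_congr fun σ ↦ forall_congr' fun i ↦ forall_congr' fun j ↦ forall_congr' fun T ↦
    forall_congr' fun a ↦ forall_congr' fun b ↦ forall_congr' fun t ↦ ?_
  change γ.val a b t * σ j (b.left t) * (δ.val a b t)⁻¹ = _ ↔ _
  rw [mul_inv_eq_iff_eq_mul, eq_comm]

theorem injective_pullback_of_isPGroup {p : ℕ} [Fact p.Prime] [ConnectedSpace S']
    (hf : Function.Injective (H1.pullback f (Multiplicative (ZMod p)))) {G : Type w} [Group G]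
    [Finite G] (hG : IsPGroup p G) : Function.Injective (H1.pullback f G) := by
  refine H1.pullback_injective_iff.mpr fun 𝒰 𝒲 m γ δ h ↦ ?_
  let := biMulAction G
  have hGG : IsPGroup p (G × G) := by
    obtain ⟨n, hn⟩ := IsPGroup.iff_card.mp hG
    exact IsPGroup.of_card (n := n + n) (by rw [Nat.card_prod, hn, pow_add])
  obtain ⟨𝒱, n, hn⟩ := HasTwistedSection.exists_refinement hf hGG m (δ.prod γ)
    ((hasTwistedSection_prod_iff (m.pullbackCocycle δ) (m.pullbackCocycle γ)).mpr h)
  exact ⟨𝒱, n, (hasTwistedSection_prod_iff (n.pullbackCocycle δ) (n.pullbackCocycle γ)).mp hn⟩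

theorem injective_pullback_zmod_of_isPGroup {p : ℕ} [Fact p.Prime] {G : Type w} [Group G]
    [Finite G] [Nontrivial G] (hG : IsPGroup p G) (hf : Function.Injective (H1.pullback f G)) :
    Function.Injective (H1.pullback f (Multiplicative (ZMod p))) := by
  obtain ⟨j, hj, hcentral⟩ := exists_injective_central_zmod hG
  refine H1.pullback_injective_iff.mpr fun 𝒰 𝒲 m γ δ h ↦ ?_
  obtain ⟨𝒱, n, hn⟩ := H1.pullback_injective_iff.mp hf 𝒰 𝒲 m (γ.map j) (δ.map j)
    (Cocycle.isCohomologous_map j h)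
  exact ⟨𝒱, n, Cocycle.isCohomologous_of_map_central (γ := n.pullbackCocycle γ)
    (δ := n.pullbackCocycle δ) hj hcentral hn⟩

end TwistedSections

/-! ### Descent along finite families of flat algebras -/

section Descent

open TensorProduct

variable {A : Type*} [CommRing A] {ι : Type*} {B : ι → Type*} [∀ i, CommRing (B i)]
  [∀ i, Algebra A (B i)]

/-- The differential `(bᵢ) ↦ (bᵢ ⊗ 1 - 1 ⊗ bⱼ)` from `0`-cochains to `1`-cochains of the Amitsur
complex of a family of algebras. -/
noncomputable def amitsurDifferential (A : Type*) [CommRing A] {ι : Type*} (B : ι → Type*)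
    [∀ i, CommRing (B i)] [∀ i, Algebra A (B i)] :
    (∀ i, B i) →ₗ[A] ∀ z : ι × ι, B z.1 ⊗[A] B z.2 :=
  LinearMap.pi fun z ↦
    (Algebra.TensorProduct.includeLeft (R := A) (S := A)).toLinearMap ∘ₗ LinearMap.proj z.1 -
    (Algebra.TensorProduct.includeRight (R := A)).toLinearMap ∘ₗ LinearMap.proj z.2

lemma piRight_lTensor_amitsurDifferential [Fintype ι] [DecidableEq ι] (l : ι)
    (x : B l ⊗[A] (∀ i, B i)) (i j : ι) :
    piRight A A (B l) _ ((amitsurDifferential A B).lTensor (B l) x) (i, j) =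
      Algebra.TensorProduct.map (.id A (B l))
        (Algebra.TensorProduct.includeLeft : B i →ₐ[A] B i ⊗[A] B j)
        (piRight A A (B l) B x i) -
      Algebra.TensorProduct.map (.id A (B l))
        (Algebra.TensorProduct.includeRight : B j →ₐ[A] B i ⊗[A] B j)
        (piRight A A (B l) B x j) := by
  induction x with
  | zero => simp
  | tmul x y => simp [amitsurDifferential, tmul_sub]
  | add x y hx hy =>
    simp only [map_add, Pi.add_apply, hx, hy]
    abel

variable [Finite ι] [∀ i, Module.Flat A (B i)]

lemma faithfullyFlat_pi (hB : ∀ q : PrimeSpectrum A, ∃ (i : ι) (Q : PrimeSpectrum (B i)),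
    Q.comap (algebraMap A (B i)) = q) : Module.FaithfullyFlat A (∀ i, B i) := by
  have := Fintype.ofFinite ι
  have : Module.Flat A (∀ i, B i) :=
    .of_linearEquiv (DFinsupp.linearEquivFunOnFintype (R := A) (M := B)).symm
  refine .of_comap_surjective fun q ↦ ?_
  obtain ⟨i, Q, rfl⟩ := hB q
  exact ⟨Q.comap (Pi.evalRingHom B i), rfl⟩

lemma eq_zero_of_forall_one_tmul_eq_zero
    (hB : ∀ q : PrimeSpectrum A, ∃ (i : ι) (Q : PrimeSpectrum (B i)),
      Q.comap (algebraMap A (B i)) = q)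
    {M : Type*} [AddCommGroup M] [Module A M] {m : M}
    (hm : ∀ i, (1 : B i) ⊗ₜ[A] m = 0) : m = 0 := by
  classical
  have := Fintype.ofFinite ι
  have := faithfullyFlat_pi hB
  refine (Module.FaithfullyFlat.one_tmul_eq_zero_iff A M (A := ∀ i, B i) m).mp ?_
  refine (TensorProduct.piLeft A M B).injective ?_
  funext i
  simpa using hm i

lemma exists_algebraMap_eq_of_tmul_eq
    (hB : ∀ q : PrimeSpectrum A, ∃ (i : ι) (Q : PrimeSpectrum (B i)),
      Q.comap (algebraMap A (B i)) = q)
    (y : ∀ i, B i) (hy : ∀ i j, y i ⊗ₜ[A] (1 : B j) = (1 : B i) ⊗ₜ[A] y j) :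
    ∃ a : A, ∀ i, algebraMap A (B i) a = y i := by
  classical
  have := Fintype.ofFinite ι
  let R := LinearMap.range (Algebra.linearMap A (∀ i, B i))
  have hyR : R.mkQ y = 0 := by
    refine eq_zero_of_forall_one_tmul_eq_zero hB fun i ↦ ?_
    have hyi : (1 : B i) ⊗ₜ[A] y = y i ⊗ₜ[A] (1 : ∀ j, B j) := by
      refine (TensorProduct.piRight A A (B i) B).injective ?_
      funext j
      simpa using (hy i j).symm
    have h1 : R.mkQ 1 = 0 := (Submodule.Quotient.mk_eq_zero _).mpr ⟨1, by simp⟩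
    rw [← LinearMap.lTensor_tmul, hyi, LinearMap.lTensor_tmul, h1, tmul_zero]
  obtain ⟨a, ha⟩ := (Submodule.Quotient.mk_eq_zero _).mp hyR
  exact ⟨a, fun i ↦ congrFun ha i⟩

lemma exists_sub_eq_of_cocycle
    (hB : ∀ q : PrimeSpectrum A, ∃ (i : ι) (Q : PrimeSpectrum (B i)),
      Q.comap (algebraMap A (B i)) = q)
    (c : ∀ i j, B i ⊗[A] B j)
    (hc : ∀ l i j, (1 : B l) ⊗ₜ[A] c i j =
      Algebra.TensorProduct.map (.id A (B l))
        (Algebra.TensorProduct.includeRight : B j →ₐ[A] B i ⊗[A] B j) (c l j) -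
      Algebra.TensorProduct.map (.id A (B l))
        (Algebra.TensorProduct.includeLeft : B i →ₐ[A] B i ⊗[A] B j) (c l i)) :
    ∃ b : ∀ i, B i, ∀ i j, c i j = b i ⊗ₜ[A] (1 : B j) - (1 : B i) ⊗ₜ[A] b j := by
  classical
  have := Fintype.ofFinite ι
  let d := amitsurDifferential A B
  let c' : ∀ z : ι × ι, B z.1 ⊗[A] B z.2 := fun z ↦ c z.1 z.2
  have hcd : (LinearMap.range d).mkQ c' = 0 := by
    refine eq_zero_of_forall_one_tmul_eq_zero hB fun l ↦ ?_
    -- After base change to `B l`, the family `-c l` is a primitive of `c`.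
    have hcl : (1 : B l) ⊗ₜ[A] c' =
        d.lTensor (B l) (-(piRight A A (B l) B).symm fun i ↦ c l i) := by
      refine (piRight A A (B l) fun z : ι × ι ↦ B z.1 ⊗[A] B z.2).injective ?_
      funext ⟨i, j⟩
      rw [piRight_lTensor_amitsurDifferential]
      simp only [map_neg, Pi.neg_apply, LinearEquiv.apply_symm_apply, piRight_apply,
        piRightHom_tmul, neg_sub_neg, ← hc l i j, c']
    rw [← LinearMap.lTensor_tmul, hcl, ← LinearMap.comp_apply, ← LinearMap.lTensor_comp,
      LinearMap.range_mkQ_comp, LinearMap.lTensor_zero, LinearMap.zero_apply]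
  obtain ⟨b, hb⟩ := (Submodule.Quotient.mk_eq_zero _).mp hcd
  exact ⟨b, fun i j ↦ (congrFun hb (i, j)).symm⟩

end Descent

/-! ### Frobenius-fixed functions and their values in `ZMod p` -/

section FrobeniusFixed

variable {p : ℕ}

lemma cast_eq_zero_of_ringHom {R R' : Type*} [CommRing R] [CommRing R'] (f : R →+* R')
    (h : (p : R) = 0) : (p : R') = 0 := by
  rw [← map_natCast f, h, map_zero]

variable [Fact p.Prime] {R : Type*} [CommRing R]

lemma sub_pow_of_cast_eq_zero (h : (p : R) = 0) (x y : R) : (x - y) ^ p = x ^ p - y ^ p := by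
  cases subsingleton_or_nontrivial R
  · exact Subsingleton.elim _ _
  · have := (CharP.charP_iff_prime_eq_zero Fact.out).mpr h
    exact sub_pow_char x y

lemma sum_pow_of_cast_eq_zero (h : (p : R) = 0) {ι : Type*} (s : Finset ι) (x : ι → R) :
    (∑ i ∈ s, x i) ^ p = ∑ i ∈ s, x i ^ p := by
  cases subsingleton_or_nontrivial R
  · exact Subsingleton.elim _ _
  · have := (CharP.charP_iff_prime_eq_zero Fact.out).mpr h
    exact sum_pow_char p s x

lemma map_zmod_cast {R R' : Type*} [CommRing R] [CommRing R'] (f : R →+* R') (c : ZMod p) :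
    f c.cast = c.cast := by
  rw [ZMod.cast_eq_val, map_natCast, ZMod.cast_eq_val]

lemma cast_pow_of_cast_eq_zero (h : (p : R) = 0) (c : ZMod p) : (c.cast : R) ^ p = c.cast := by
  rw [← ZMod.cast_pow (ringChar.dvd h), ZMod.pow_card]

lemma eq_zero_of_pow_eq_self_of_not_isUnit [IsLocalRing R] {x : R} (hx : x ^ p = x)
    (h : ¬IsUnit x) : x = 0 := by
  have hp : p.Prime := Fact.out
  have hfactor : (1 - x ^ (p - 1)) * x = 0 := by
    rw [sub_mul, one_mul, pow_sub_one_mul hp.ne_zero, hx, sub_self]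
  have hunit : IsUnit (1 - x ^ (p - 1)) := by
    refine (IsLocalRing.isUnit_or_isUnit_one_sub_self (x ^ (p - 1))).resolve_left ?_
    exact (isUnit_pow_iff (Nat.sub_ne_zero_of_lt hp.one_lt)).not.mpr h
  exact hunit.mul_right_eq_zero.mp hfactor

lemma exists_cast_eq_of_pow_eq_self {K : Type*} [Field K] (hK : (p : K) = 0) {x : K}
    (hx : x ^ p = x) : ∃ c : ZMod p, c.cast = x := by
  have := (CharP.charP_iff_prime_eq_zero Fact.out).mpr hK
  obtain ⟨c, hc⟩ : x ∈ (ZMod.castHom dvd_rfl K).fieldRange := by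
    rwa [ZMod.fieldRange_castHom_eq_bot, Subfield.mem_bot_iff_pow_eq_self]
  exact ⟨c, hc⟩

end FrobeniusFixed

section Values

variable {p : ℕ} {T T' : Scheme.{u}}

/-- The function `x` takes the value `φ t` in the residue field of every point `t`. -/
def HasValues (x : Γ(T, ⊤)) (φ : T → ZMod p) : Prop :=
  ∀ t, T.Γevaluation t x = (φ t).cast

variable [Fact p.Prime]

lemma charP_residueField (hT : (p : Γ(T, ⊤)) = 0) (t : T) : CharP (T.residueField t) p :=
  (CharP.charP_iff_prime_eq_zero Fact.out).mpr (cast_eq_zero_of_ringHom (T.Γevaluation t).hom hT)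

lemma notMem_basicOpen_sub_cast_iff (x : Γ(T, ⊤)) (c : ZMod p) (t : T) :
    t ∉ T.basicOpen (x - c.cast) ↔ T.Γevaluation t x = c.cast := by
  rw [← T.evaluation_eq_zero_iff_notMem_basicOpen (U := ⊤) t trivial, map_sub, sub_eq_zero]
  exact (map_zmod_cast (T.Γevaluation t).hom c).congr_right

namespace HasValues

variable {x y : Γ(T, ⊤)} {φ ψ : T → ZMod p}

lemma unique (hT : (p : Γ(T, ⊤)) = 0) (hφ : HasValues x φ) (hψ : HasValues x ψ) : φ = ψ := by
  funext t
  have := charP_residueField hT t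
  exact ZMod.castHom_injective (T.residueField t) ((hφ t).symm.trans (hψ t))

lemma add (hT : (p : Γ(T, ⊤)) = 0) (hφ : HasValues x φ) (hψ : HasValues y ψ) :
    HasValues (x + y) (fun t ↦ φ t + ψ t) := fun t ↦ by
  have := charP_residueField hT t
  rw [map_add, hφ t, hψ t, ZMod.cast_add']

lemma sub (hT : (p : Γ(T, ⊤)) = 0) (hφ : HasValues x φ) (hψ : HasValues y ψ) :
    HasValues (x - y) (fun t ↦ φ t - ψ t) := fun t ↦ by
  have := charP_residueField hT t
  rw [map_sub, hφ t, hψ t, ZMod.cast_sub']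

lemma comp (hφ : HasValues x φ) (g : T' ⟶ T) : HasValues (g.appTop x) (fun t ↦ φ (g t)) :=
  fun t ↦ by
    rw [← Scheme.Γevaluation_naturality_apply, hφ (g t)]
    exact map_zmod_cast (g.residueFieldMap t).hom _

lemma eq (hT : (p : Γ(T, ⊤)) = 0) (hx : x ^ p = x) (hy : y ^ p = y) (hxφ : HasValues x φ)
    (hyφ : HasValues y φ) : x = y := by
  refine TopCat.Presheaf.section_ext T.sheaf ⊤ _ _ fun t ht ↦ sub_eq_zero.mp ?_
  change T.presheaf.germ ⊤ t ht x - T.presheaf.germ ⊤ t ht y = 0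
  rw [← map_sub]
  refine eq_zero_of_pow_eq_self_of_not_isUnit (p := p) ?_ ?_
  · rw [← map_pow, sub_pow_of_cast_eq_zero hT, hx, hy]
  · rw [← Scheme.mem_basicOpen_top,
      ← T.evaluation_eq_zero_iff_notMem_basicOpen (U := ⊤) t trivial, map_sub, sub_eq_zero]
    exact (hxφ t).trans (hyφ t).symm

end HasValues

lemma exists_hasValues (hT : (p : Γ(T, ⊤)) = 0) {x : Γ(T, ⊤)} (hx : x ^ p = x) :
    ∃ φ : LocallyConstant T (ZMod p), HasValues x φ := by
  have hval (t : T) : ∃ c : ZMod p, c.cast = T.Γevaluation t x :=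
    exists_cast_eq_of_pow_eq_self (cast_eq_zero_of_ringHom (T.Γevaluation t).hom hT)
      (by rw [← map_pow, hx])
  choose φ hφ using hval
  have hfiber (c : ZMod p) : φ ⁻¹' {c} = (T.basicOpen (x - c.cast) : Set T)ᶜ := by
    ext t
    have := charP_residueField hT t
    rw [Set.mem_compl_iff, SetLike.mem_coe, notMem_basicOpen_sub_cast_iff, ← hφ]
    exact (ZMod.castHom_injective (T.residueField t)).eq_iff.symm
  refine ⟨⟨φ, (IsLocallyConstant.iff_continuous φ).mpr <|
    continuous_iff_isClosed.mpr fun s _ ↦ ?_⟩, fun t ↦ (hφ t).symm⟩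
  rw [← Set.biUnion_preimage_singleton]
  refine s.toFinite.isClosed_biUnion fun c _ ↦ ?_
  rw [hfiber]
  exact (T.basicOpen _).isOpen.isClosed_compl

end Values

section PullFn

variable {T T' : Scheme.{u}} {R R' : CommRingCat.{u}}

/-- The pullback of functions along a morphism to an affine scheme. -/
noncomputable def pullFn (a : T ⟶ Spec R) : R →+* Γ(T, ⊤) :=
  ((Scheme.ΓSpecIso R).inv ≫ a.appTop).hom

lemma pullFn_comp (g : T' ⟶ T) (a : T ⟶ Spec R) (x : R) :
    pullFn (g ≫ a) x = g.appTop (pullFn a x) := by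
  simp only [pullFn, Scheme.Hom.comp_appTop]
  rfl

lemma pullFn_comp_specMap (g : T ⟶ Spec R') (φ : R ⟶ R') (x : R) :
    pullFn (g ≫ Spec.map φ) x = pullFn g (φ x) := by
  have h := congrArg (fun q ↦ q.hom x) (Scheme.ΓSpecIso_inv_naturality φ)
  simp only [CommRingCat.comp_apply] at h
  simp only [pullFn, Scheme.Hom.comp_appTop]
  exact congrArg g.appTop h.symm

lemma pullFn_specMap (φ : R ⟶ R') (x : R) : pullFn (Spec.map φ) x = pullFn (𝟙 _) (φ x) := by
  rw [← pullFn_comp_specMap, Category.id_comp]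

lemma appTop_pullFn_id (a : T ⟶ Spec R) (x : R) : a.appTop (pullFn (𝟙 _) x) = pullFn a x := by
  rw [← pullFn_comp, Category.comp_id]

lemma pullFn_id_bijective : Function.Bijective (pullFn (𝟙 (Spec R))) := by
  have h : pullFn (𝟙 (Spec R)) = (Scheme.ΓSpecIso R).inv.hom := by simp [pullFn]
  rw [h]
  exact (ConcreteCategory.isIso_iff_bijective _).mp inferInstance

lemma basicOpen_pullFn_id (x : R) :
    (Spec R).basicOpen (pullFn (𝟙 _) x) = PrimeSpectrum.basicOpen x := by
  rw [← basicOpen_eq_of_affine, pullFn, Scheme.Hom.id_appTop, Category.comp_id]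

end PullFn

section FrobeniusFixedSpec

variable {p : ℕ} [Fact p.Prime] {R : CommRingCat.{u}}

lemma evaluation_pullFn_id_of_isIdempotentElem {e : R} (he : IsIdempotentElem e) (t : Spec R)
    [Decidable (e ∈ t.asIdeal)] :
    (Spec R).Γevaluation t (pullFn (𝟙 _) e) = if e ∈ t.asIdeal then 0 else 1 := by
  have hzero : (Spec R).Γevaluation t (pullFn (𝟙 _) e) = 0 ↔ e ∈ t.asIdeal := by
    refine ((Spec R).evaluation_eq_zero_iff_notMem_basicOpen (U := ⊤) t trivial _).trans ?_
    rw [basicOpen_pullFn_id]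
    exact not_not
  split_ifs with h
  · exact hzero.mpr h
  · exact (IsIdempotentElem.iff_eq_zero_or_one.mp
      ((he.map (pullFn (𝟙 _))).map ((Spec R).Γevaluation t).hom)).resolve_left (hzero.not.mpr h)

lemma exists_hasValues_pullFn_id (hR : (p : R) = 0) (φ : LocallyConstant (Spec R) (ZMod p)) :
    ∃ x : R, x ^ p = x ∧ HasValues (pullFn (𝟙 _) x) φ := by
  classical
  choose e he hφe using fun c : ZMod p ↦ PrimeSpectrum.exists_idempotent_basicOpen_eq_of_isClopen
    (φ.isLocallyConstant.isClopen_fiber c)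
  refine ⟨∑ c : ZMod p, c.cast * e c, ?_, fun t ↦ ?_⟩
  · rw [sum_pow_of_cast_eq_zero hR]
    refine Finset.sum_congr rfl fun c _ ↦ ?_
    rw [mul_pow, cast_pow_of_cast_eq_zero hR, (he c).pow_eq (Fact.out : p.Prime).ne_zero]
  · have hcast (c : ZMod p) : (Spec R).Γevaluation t (pullFn (𝟙 _) c.cast) = c.cast :=
      map_zmod_cast (((Spec R).Γevaluation t).hom.comp (pullFn (𝟙 _))) c
    have hmem (c : ZMod p) : e c ∈ t.asIdeal ↔ φ t ≠ c :=
      (not_iff_comm.mp (Set.ext_iff.mp (hφe c) t).symm).symm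
    simp [hcast, evaluation_pullFn_id_of_isIdempotentElem (he _), hmem]

end FrobeniusFixedSpec

/-! ### Finite affine étale coverings of affine schemes -/

section OverSpec

open TensorProduct

variable {A B B' B'' : Type u} [CommRing A] [CommRing B] [CommRing B'] [CommRing B''] [Algebra A B]
  [Algebra A B'] [Algebra A B'']

/-- The spectrum of an `A`-algebra as a scheme over `Spec A`. -/
noncomputable abbrev overSpec (A B : Type u) [CommRing A] [CommRing B] [Algebra A B] :
    Over (Spec (.of A)) :=
  Over.mk (Spec.map (CommRingCat.ofHom (algebraMap A B)))

/-- The morphism of schemes over `Spec A` given by a homomorphism of `A`-algebras. -/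
noncomputable def overSpecMap (ρ : B →ₐ[A] B') : overSpec A B' ⟶ overSpec A B :=
  Over.homMk (Spec.map (CommRingCat.ofHom ρ.toRingHom)) (by
    change Spec.map _ ≫ Spec.map _ = Spec.map _
    rw [← Spec.map_comp, ← CommRingCat.ofHom_comp]
    exact congrArg (fun σ ↦ Spec.map (CommRingCat.ofHom σ)) ρ.comp_algebraMap)

lemma overSpecMap_comp (ρ : B →ₐ[A] B') (σ : B' →ₐ[A] B'') :
    overSpecMap σ ≫ overSpecMap ρ = overSpecMap (σ.comp ρ) :=
  Over.OverMorphism.ext (Spec.map_comp _ _).symm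

lemma pullFn_overSpecMap (ρ : B →ₐ[A] B') (x : B) :
    pullFn (R := .of B) (overSpecMap ρ).left x = pullFn (𝟙 (Spec (.of B'))) (ρ x) :=
  pullFn_specMap (R := .of B) (R' := .of B') _ x

lemma pullFn_comp_overSpecMap {T : Over (Spec (.of A))} (g : T ⟶ overSpec A B') (ρ : B →ₐ[A] B')
    (x : B) : pullFn (R := .of B) (g ≫ overSpecMap ρ).left x = pullFn (R := .of B') g.left (ρ x) :=
  pullFn_comp_specMap (R := .of B) (R' := .of B') g.left _ x

lemma exists_hom_overSpec_tensorProduct {T : Over (Spec (.of A))} (a : T ⟶ overSpec A B)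
    (b : T ⟶ overSpec A B') : ∃ g : T ⟶ overSpec A (B ⊗[A] B'),
      g ≫ overSpecMap Algebra.TensorProduct.includeLeft = a ∧
      g ≫ overSpecMap Algebra.TensorProduct.includeRight = b := by
  have hpb := isPullback_SpecMap_of_isPushout _ _ _ _ (CommRingCat.isPushout_tensorProduct A B B')
  have hab : a.left ≫ Spec.map (CommRingCat.ofHom (algebraMap A B)) =
      b.left ≫ Spec.map (CommRingCat.ofHom (algebraMap A B')) := (Over.w a).trans (Over.w b).symm
  refine ⟨Over.homMk (hpb.lift _ _ hab) ?_, Over.OverMorphism.ext (hpb.lift_fst _ _ hab),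
    Over.OverMorphism.ext (hpb.lift_snd _ _ hab)⟩
  have hleft : Spec.map (CommRingCat.ofHom Algebra.TensorProduct.includeLeftRingHom) ≫
      (overSpec A B).hom = (overSpec A (B ⊗[A] B')).hom :=
    Over.w (overSpecMap (Algebra.TensorProduct.includeLeft : B →ₐ[A] B ⊗[A] B'))
  rw [← hleft, hpb.lift_fst_assoc]
  exact Over.w a

end OverSpec

/-- Finite étale coverings of `Spec A` by affine schemes. -/
structure AffineCover (A : Type u) [CommRing A] where
  /-- The index set. -/
  ι : Type u
  /-- The rings of functions on the members of the covering. -/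
  B : ι → Type u
  [finite : Finite ι]
  [commRing (i : ι) : CommRing (B i)]
  [algebra (i : ι) : Algebra A (B i)]
  [etale (i : ι) : Algebra.Etale A (B i)]
  exists_comap_eq (q : PrimeSpectrum A) :
    ∃ (i : ι) (Q : PrimeSpectrum (B i)), Q.comap (algebraMap A (B i)) = q

namespace AffineCover

variable {A : Type u} [CommRing A] (𝒱 : AffineCover A)

attribute [instance] finite commRing algebra etale

/-- The underlying étale covering. -/
noncomputable abbrev toEtaleCover : EtaleCover (Spec (.of A)) where
  I₀ := 𝒱.ι
  X i := Spec (.of (𝒱.B i))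
  f i := Spec.map (CommRingCat.ofHom (algebraMap A (𝒱.B i)))
  etale i := by
    rw [HasRingHomProperty.Spec_iff (P := @Etale)]
    exact RingHom.etale_algebraMap.mpr (𝒱.etale i)
  exists_eq := 𝒱.exists_comap_eq

end AffineCover

lemma EtaleCover.exists_affine_refinement {A : Type u} [CommRing A]
    (𝒰 : EtaleCover (Spec (.of A))) :
    ∃ 𝒱 : AffineCover A, Nonempty (CoverMap (𝟙 (Spec (.of A))) 𝒱.toEtaleCover 𝒰) := by
  have hloc (x : Spec (.of A)) : ∃ (i : 𝒰.I₀) (U : (𝒰.X i).Opens), IsAffineOpen U ∧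
      x ∈ 𝒰.f i '' U := by
    obtain ⟨i, z, hz⟩ := 𝒰.exists_eq x
    obtain ⟨U, hU, hzU, -⟩ := exists_isAffineOpen_mem_and_subset (x := z) (U := ⊤) trivial
    exact ⟨i, U, hU, z, hzU, hz⟩
  choose i U hU hx using hloc
  have hopen (x) : IsOpen (𝒰.f (i x) '' U x) := by
    have := 𝒰.etale (i x)
    exact (𝒰.f (i x)).isOpenMap _ (U x).2
  obtain ⟨t, ht⟩ := isCompact_univ.elim_finite_subcover _ hopen
    fun x _ ↦ Set.mem_iUnion.mpr ⟨x, hx x⟩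
  let φ (x : t) : .of A ⟶ Γ(𝒰.X (i x), U x) := Spec.preimage ((hU x).fromSpec ≫ 𝒰.f (i x))
  have hφ (x : t) : Spec.map (φ x) = (hU x).fromSpec ≫ 𝒰.f (i x) := Spec.map_preimage _
  let 𝒱 : AffineCover A :=
    { ι := t
      B x := Γ(𝒰.X (i x), U x)
      algebra x := (φ x).hom.toAlgebra
      etale x := by
        have := 𝒰.etale (i x)
        have h : Etale (Spec.map (φ x)) := hφ x ▸ inferInstance
        rwa [HasRingHomProperty.Spec_iff (P := @Etale)] at h
      exists_comap_eq q := by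
        obtain ⟨x, hxt, z, hz, hzq⟩ := Set.mem_iUnion₂.mp (ht (Set.mem_univ q))
        obtain ⟨Q, hQ⟩ : z ∈ Set.range (hU x).fromSpec := by rwa [(hU x).range_fromSpec]
        refine ⟨⟨x, hxt⟩, Q, ?_⟩
        change Spec.map (φ ⟨x, hxt⟩) Q = q
        rw [hφ, Scheme.Hom.comp_apply, hQ, hzq] }
  refine ⟨𝒱, ⟨⟨fun x ↦ i x.1, fun x ↦ (hU x.1).fromSpec, fun x ↦ ?_⟩⟩⟩
  rw [Category.comp_id]
  exact (hφ x).symm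

/-! ### Artin–Schreier algebras -/

section ArtinSchreierAlgebra

open Polynomial

variable {p : ℕ} {A : Type u} [CommRing A]

/-- The Artin–Schreier polynomial. -/
noncomputable def asPoly (p : ℕ) (a : A) : A[X] := X ^ p - X - C a

lemma asPoly_eq (a : A) : asPoly p a = X ^ p - (X + C a) := by rw [asPoly, sub_sub]

lemma root_asPoly_pow_sub (a : A) :
    AdjoinRoot.root (asPoly p a) ^ p - AdjoinRoot.root (asPoly p a) = algebraMap A _ a := by
  have h := AdjoinRoot.eval₂_root (asPoly p a)
  rwa [asPoly, eval₂_sub, eval₂_sub, eval₂_pow, eval₂_X, eval₂_C, sub_eq_zero] at h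

variable [Fact p.Prime]

lemma monic_asPoly (a : A) : (asPoly p a).Monic := by
  rw [asPoly_eq]
  have h : (X + C a).degree ≤ 1 := by compute_degree
  exact monic_X_pow_sub (h.trans_lt (by exact_mod_cast (Fact.out : p.Prime).one_lt))

lemma injective_algebraMap_asPoly (a : A) :
    Function.Injective (algebraMap A (AdjoinRoot (asPoly p a))) := by
  nontriviality A
  rw [injective_iff_map_eq_zero]
  intro c hc
  by_contra hc₀
  have hlt : (X + C a).natDegree < (X ^ p : A[X]).natDegree := by
    rw [natDegree_X_add_C, natDegree_X_pow]
    exact (Fact.out : p.Prime).one_lt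
  refine (monic_asPoly (p := p) a).not_dvd_of_natDegree_lt (C_ne_zero.mpr hc₀) ?_
    (AdjoinRoot.mk_eq_zero.mp hc)
  rw [natDegree_C, asPoly_eq, natDegree_sub_eq_left_of_natDegree_lt hlt, natDegree_X_pow]
  exact (Fact.out : p.Prime).pos

lemma etale_asPoly (hA : (p : A) = 0) (a : A) : Algebra.Etale A (AdjoinRoot (asPoly p a)) := by
  let P : StandardEtalePair A := ⟨asPoly p a, monic_asPoly a, 1, -1, 0, 0, by
    simp [asPoly, derivative_X_pow, hA]⟩
  have hunit : IsUnit (AdjoinRoot.mk P.f P.g) := by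
    rw [show P.g = 1 from rfl, map_one]
    exact isUnit_one
  let e : AdjoinRoot (asPoly p a) ≃ₐ[A] Localization.Away (AdjoinRoot.mk P.f P.g) :=
    (IsLocalization.atUnit (AdjoinRoot P.f) (Localization.Away (AdjoinRoot.mk P.f P.g)) _
      hunit).restrictScalars A
  exact .of_equiv (P.equivAwayAdjoinRoot.trans e.symm)

/-- The étale covering of `Spec A` given by an Artin–Schreier equation. -/
noncomputable def asCover (hA : (p : A) = 0) (a : A) : AffineCover A where
  ι := PUnit
  B _ := AdjoinRoot (asPoly p a)
  etale _ := etale_asPoly hA a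
  exists_comap_eq q := by
    have := (monic_asPoly (p := p) a).finite_adjoinRoot
    have hintegral := algebraMap_isIntegral_iff.mpr
      (inferInstance : Algebra.IsIntegral A (AdjoinRoot (asPoly p a)))
    obtain ⟨Q, hQ⟩ := hintegral.comap_surjective (injective_algebraMap_asPoly a) q
    exact ⟨⟨⟩, Q, hQ⟩

end ArtinSchreierAlgebra

/-! ### Coboundaries of functions -/

lemma Cocycle.one_isCohomologous_iff {p : ℕ} {S : Scheme.{u}} {𝒰 : EtaleCover S}
    (d : Cocycle (Multiplicative (ZMod p)) 𝒰) :
    (1 : Cocycle (Multiplicative (ZMod p)) 𝒰).IsCohomologous d ↔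
      ∃ φ : ∀ i, LocallyConstant (𝒰.X i) (ZMod p), ∀ (i j : 𝒰.I₀) {T : Over S}
        (a : T ⟶ Over.mk (𝒰.f i)) (b : T ⟶ Over.mk (𝒰.f j)) (t : T.left),
        (d.val a b t).toAdd = φ i (a.left t) - φ j (b.left t) := by
  rw [Cocycle.isCohomologous_iff]
  constructor
  · rintro ⟨α, hα⟩
    refine ⟨fun i ↦ (α i).map Multiplicative.toAdd, fun i j T a b t ↦ eq_sub_of_add_eq ?_⟩
    exact (congrArg Multiplicative.toAdd (hα i j a b t)).symm.trans
      (congrArg Multiplicative.toAdd (mul_one _))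
  · rintro ⟨φ, hφ⟩
    refine ⟨fun i ↦ (φ i).map Multiplicative.ofAdd, fun i j T a b t ↦ ?_⟩
    exact Multiplicative.toAdd.injective
      ((add_zero _).trans (sub_eq_iff_eq_add.mp (hφ i j a b t).symm))

section Represents

variable {p : ℕ} {S S' : Scheme.{u}}

/-- The pullback of functions on an `S`-scheme to an `S`-scheme mapping to it. -/
noncomputable def pullSection {X : Scheme.{u}} {q : X ⟶ S} {T : Over S} (a : T ⟶ Over.mk q) :
    Γ(X, ⊤) →+* Γ(T.left, ⊤) :=
  (Scheme.Hom.appTop (Y := X) a.left).hom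

lemma pullSection_precomp {X : Scheme.{u}} {q : X ⟶ S} {T T' : Over S} (g : T' ⟶ T)
    (a : T ⟶ Over.mk q) (x : Γ(X, ⊤)) :
    pullSection (g ≫ a) x = g.left.appTop (pullSection a x) := by
  simp only [pullSection, Over.comp_left, Scheme.Hom.comp_appTop]
  rfl

lemma pullSection_appTop {X : Scheme.{u}} {q : X ⟶ S} {T : Over S} (a : T ⟶ Over.mk q)
    (s : Γ(S, ⊤)) : pullSection a (q.appTop s) = T.hom.appTop s := by
  rw [← show a.left ≫ q = T.hom from Over.w a, Scheme.Hom.comp_appTop]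
  rfl

lemma cast_left_eq_zero (hS : (p : Γ(S, ⊤)) = 0) (T : Over S) : (p : Γ(T.left, ⊤)) = 0 :=
  cast_eq_zero_of_ringHom T.hom.appTop.hom hS

variable {f : S' ⟶ S} {𝒰 : EtaleCover S} {𝒲 : EtaleCover S'}

lemma CoverMap.pullSection_push (m : CoverMap f 𝒲 𝒰) {i : 𝒲.I₀} {T : Over S'}
    (a : T ⟶ Over.mk (𝒲.f i)) (x : Γ(𝒰.X (m.idx i), ⊤)) :
    pullSection (m.push a) x = pullSection a ((m.hom i).appTop x) := by
  have h : (m.push a).left = a.left ≫ m.hom i := rfl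
  simp only [pullSection, h, Scheme.Hom.comp_appTop]
  rfl

lemma CoverMap.appTop_hom (m : CoverMap f 𝒲 𝒰) (i : 𝒲.I₀) (c : Γ(S, ⊤)) :
    (m.hom i).appTop ((𝒰.f (m.idx i)).appTop c) = (𝒲.f i).appTop (f.appTop c) := by
  have h := congrArg (fun q ↦ Scheme.Hom.appTop q c) (m.comm i)
  simpa only [Scheme.Hom.comp_appTop, CommRingCat.comp_apply] using h

lemma CoverMap.artinSchreier_appTop_hom (m : CoverMap f 𝒲 𝒰) {θ : ∀ i, Γ(𝒰.X i, ⊤)}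
    {c : Γ(S, ⊤)} (hθ : ∀ i, θ i ^ p - θ i = (𝒰.f i).appTop c) (i : 𝒲.I₀) :
    (m.hom i).appTop (θ (m.idx i)) ^ p - (m.hom i).appTop (θ (m.idx i)) =
      (𝒲.f i).appTop (f.appTop c) := by
  rw [← map_pow, ← map_sub, hθ, m.appTop_hom]

/-- The cocycle `d` is the coboundary of the family of functions `θ`. -/
def Represents (d : Cocycle (Multiplicative (ZMod p)) 𝒰) (θ : ∀ i, Γ(𝒰.X i, ⊤)) : Prop :=
  ∀ (i j : 𝒰.I₀) {T : Over S} (a : T ⟶ Over.mk (𝒰.f i)) (b : T ⟶ Over.mk (𝒰.f j)),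
    HasValues (pullSection a (θ i) - pullSection b (θ j)) (fun t ↦ (d.val a b t).toAdd)

variable {d : Cocycle (Multiplicative (ZMod p)) 𝒰} {θ : ∀ i, Γ(𝒰.X i, ⊤)}

lemma Represents.pullback (h : Represents d θ) (m : CoverMap f 𝒲 𝒰) :
    Represents (m.pullbackCocycle d) (fun i ↦ (m.hom i).appTop (θ (m.idx i))) := by
  intro i j T a b
  have hab := h _ _ (m.push a) (m.push b)
  rw [m.pullSection_push, m.pullSection_push] at hab
  exact hab

lemma Represents.sub_const (h : Represents d θ) (s : Γ(S, ⊤)) :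
    Represents d (fun i ↦ θ i - (𝒰.f i).appTop s) := by
  intro i j T a b
  rw [map_sub, map_sub, pullSection_appTop, pullSection_appTop, sub_sub_sub_cancel_right]
  exact h i j a b

variable [Fact p.Prime]

lemma Represents.isCohomologous_one (hS : (p : Γ(S, ⊤)) = 0) (h : Represents d θ)
    (hθ : ∀ i, θ i ^ p = θ i) : (1 : Cocycle (Multiplicative (ZMod p)) 𝒰).IsCohomologous d := by
  choose φ hφ using fun i ↦ exists_hasValues
    (cast_eq_zero_of_ringHom (𝒰.f i).appTop.hom hS) (hθ i)
  refine d.one_isCohomologous_iff.mpr ⟨φ, fun i j T a b ↦ congrFun ?_⟩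
  have hT := cast_left_eq_zero hS T
  exact (h i j a b).unique hT (((hφ i).comp a.left).sub hT ((hφ j).comp b.left))

lemma Represents.sub_of_hasValues (hS : (p : Γ(S, ⊤)) = 0) (h : Represents d θ)
    {φ : ∀ i, 𝒰.X i → ZMod p}
    (hφ : ∀ (i j : 𝒰.I₀) {T : Over S} (a : T ⟶ Over.mk (𝒰.f i)) (b : T ⟶ Over.mk (𝒰.f j))
      (t : T.left), (d.val a b t).toAdd = φ i (a.left t) - φ j (b.left t))
    {y : ∀ i, Γ(𝒰.X i, ⊤)} (hy : ∀ i, HasValues (y i) (φ i)) :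
    Represents (1 : Cocycle (Multiplicative (ZMod p)) 𝒰) (fun i ↦ θ i - y i) := by
  intro i j T a b
  have hT := cast_left_eq_zero hS T
  have hsub := (h i j a b).sub hT (((hy i).comp a.left).sub hT ((hy j).comp b.left))
  simp only [hφ, sub_self] at hsub
  rw [map_sub, map_sub, sub_sub_sub_comm]
  exact hsub

lemma pullSection_sub_pow (hS : (p : Γ(S, ⊤)) = 0) {c : Γ(S, ⊤)}
    (hθ : ∀ i, θ i ^ p - θ i = (𝒰.f i).appTop c) {i j : 𝒰.I₀} {T : Over S}
    (a : T ⟶ Over.mk (𝒰.f i)) (b : T ⟶ Over.mk (𝒰.f j)) :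
    (pullSection a (θ i) - pullSection b (θ j)) ^ p =
      pullSection a (θ i) - pullSection b (θ j) := by
  rw [sub_pow_of_cast_eq_zero (cast_left_eq_zero hS T), sub_eq_sub_iff_sub_eq_sub, ← map_pow,
    ← map_pow, ← map_sub, ← map_sub, hθ, hθ, pullSection_appTop, pullSection_appTop]

lemma Represents.pullSection_eq (hS : (p : Γ(S, ⊤)) = 0) {c : Γ(S, ⊤)}
    (hθ : ∀ i, θ i ^ p - θ i = (𝒰.f i).appTop c)
    (h : Represents (1 : Cocycle (Multiplicative (ZMod p)) 𝒰) θ) {i j : 𝒰.I₀} {T : Over S}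
    (a : T ⟶ Over.mk (𝒰.f i)) (b : T ⟶ Over.mk (𝒰.f j)) :
    pullSection a (θ i) = pullSection b (θ j) := by
  have hzero : HasValues (0 : Γ(T.left, ⊤)) (fun _ ↦ (0 : ZMod p)) := fun t ↦ by simp
  exact sub_eq_zero.mp <| (h i j a b).eq (cast_left_eq_zero hS T) (pullSection_sub_pow hS hθ a b)
    (zero_pow (Fact.out : p.Prime).ne_zero) hzero

lemma exists_represents (hS : (p : Γ(S, ⊤)) = 0) {c : Γ(S, ⊤)}
    (hθ : ∀ i, θ i ^ p - θ i = (𝒰.f i).appTop c) :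
    ∃ d : Cocycle (Multiplicative (ZMod p)) 𝒰, Represents d θ := by
  choose φ hφ using fun (i j : 𝒰.I₀) (T : Over S) (a : T ⟶ Over.mk (𝒰.f i))
    (b : T ⟶ Over.mk (𝒰.f j)) ↦ exists_hasValues (cast_left_eq_zero hS T)
      (pullSection_sub_pow hS hθ a b)
  refine ⟨.ofVal (fun i j T a b t ↦ Multiplicative.ofAdd (φ i j T a b t))
    (fun i j T a b ↦ (φ i j T a b).isLocallyConstant.comp Multiplicative.ofAdd)
    (fun i j T T' g a b t ↦ ?_) (fun i j l T a b c t ↦ ?_), fun i j T a b ↦ hφ i j T a b⟩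
  · have hcomp := (hφ i j T' a b).comp g.left
    rw [map_sub, ← pullSection_precomp, ← pullSection_precomp] at hcomp
    exact congrArg Multiplicative.ofAdd <| congrFun
      (hcomp.unique (cast_left_eq_zero hS T) (hφ i j T (g ≫ a) (g ≫ b))) t
  · have hadd := (hφ i j T a b).add (cast_left_eq_zero hS T) (hφ j l T b c)
    rw [sub_add_sub_cancel] at hadd
    exact congrArg Multiplicative.ofAdd <| congrFun
      (hadd.unique (cast_left_eq_zero hS T) (hφ i l T a c)) t

end Represents

/-! ### Artin–Schreier theory on affine coverings -/

lemma pullSection_pullFn_id {A B : Type u} [CommRing A] [CommRing B] [Algebra A B]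
    {T : Over (Spec (.of A))} (a : T ⟶ overSpec A B) (x : B) :
    pullSection a (pullFn (R := .of B) (𝟙 _) x) = pullFn (R := .of B) a.left x :=
  appTop_pullFn_id (R := .of B) a.left x

namespace AffineCover

open TensorProduct

variable {p : ℕ} {A : Type u} [CommRing A] (𝒱 : AffineCover A)

lemma eq_of_forall_appTop_eq {x y : Γ(Spec (.of A), ⊤)}
    (h : ∀ i, (𝒱.toEtaleCover.f i).appTop x = (𝒱.toEtaleCover.f i).appTop y) : x = y := by
  obtain ⟨a, rfl⟩ := pullFn_id_bijective.surjective x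
  obtain ⟨b, rfl⟩ := pullFn_id_bijective.surjective y
  have hab (i) : algebraMap A (𝒱.B i) (a - b) = 0 := by
    have hi := h i
    rw [appTop_pullFn_id, appTop_pullFn_id, pullFn_specMap, pullFn_specMap] at hi
    rw [map_sub, sub_eq_zero]
    exact pullFn_id_bijective.injective hi
  refine congrArg _ (sub_eq_zero.mp ?_)
  refine eq_zero_of_forall_one_tmul_eq_zero 𝒱.exists_comap_eq fun i ↦ ?_
  rw [← mul_one (a - b), ← smul_eq_mul, tmul_smul, smul_tmul', Algebra.smul_def, mul_one, hab,
    zero_tmul]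

lemma exists_appTop_eq (θ : ∀ i, Γ(𝒱.toEtaleCover.X i, ⊤))
    (hθ : ∀ (i j : 𝒱.ι) {T : Over (Spec (.of A))} (a : T ⟶ overSpec A (𝒱.B i))
      (b : T ⟶ overSpec A (𝒱.B j)), pullSection a (θ i) = pullSection b (θ j)) :
    ∃ s, ∀ i, (𝒱.toEtaleCover.f i).appTop s = θ i := by
  choose y hy using fun i ↦ (pullFn_id_bijective (R := .of (𝒱.B i))).surjective (θ i)
  obtain ⟨s, hs⟩ := exists_algebraMap_eq_of_tmul_eq 𝒱.exists_comap_eq y fun i j ↦ by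
    have hij := hθ i j (overSpecMap Algebra.TensorProduct.includeLeft)
      (overSpecMap (Algebra.TensorProduct.includeRight : _ →ₐ[A] 𝒱.B i ⊗[A] 𝒱.B j))
    rw [← hy, ← hy, pullSection_pullFn_id, pullSection_pullFn_id, pullFn_overSpecMap,
      pullFn_overSpecMap] at hij
    exact pullFn_id_bijective.injective hij
  refine ⟨pullFn (𝟙 _) s, fun i ↦ ?_⟩
  rw [appTop_pullFn_id, pullFn_specMap, ← hy, ← hs]
  rfl

variable [Fact p.Prime]

lemma exists_artinSchreier_eq (hA : (p : A) = 0)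
    {d : Cocycle (Multiplicative (ZMod p)) 𝒱.toEtaleCover} {θ : ∀ i, Γ(𝒱.toEtaleCover.X i, ⊤)}
    (hd : Represents d θ)
    (h1 : (1 : Cocycle (Multiplicative (ZMod p)) 𝒱.toEtaleCover).IsCohomologous d)
    {c : Γ(Spec (.of A), ⊤)} (hθ : ∀ i, θ i ^ p - θ i = (𝒱.toEtaleCover.f i).appTop c) :
    ∃ s, s ^ p - s = c := by
  have hS : (p : Γ(Spec (.of A), ⊤)) = 0 := cast_eq_zero_of_ringHom (pullFn (R := .of A) (𝟙 _)) hA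
  have hB (i) : (p : 𝒱.B i) = 0 := cast_eq_zero_of_ringHom (algebraMap A _) hA
  obtain ⟨φ, hφ⟩ := d.one_isCohomologous_iff.mp h1
  choose y hy hyφ using fun i ↦ exists_hasValues_pullFn_id (R := .of (𝒱.B i)) (hB i) (φ i)
  let θ' (i) : Γ(𝒱.toEtaleCover.X i, ⊤) := θ i - pullFn (R := .of (𝒱.B i)) (𝟙 _) (y i)
  have hθ' (i) : θ' i ^ p - θ' i = (𝒱.toEtaleCover.f i).appTop c := by
    rw [sub_pow_of_cast_eq_zero (cast_eq_zero_of_ringHom (𝒱.toEtaleCover.f i).appTop.hom hS),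
      ← map_pow, hy, sub_sub_sub_cancel_right, hθ]
  have hθ'_one : Represents (1 : Cocycle (Multiplicative (ZMod p)) _) θ' :=
    hd.sub_of_hasValues hS hφ hyφ
  obtain ⟨s, hs⟩ := 𝒱.exists_appTop_eq θ' fun _ _ _ a b ↦ hθ'_one.pullSection_eq hS hθ' a b
  exact ⟨s, 𝒱.eq_of_forall_appTop_eq fun i ↦ by rw [map_sub, map_pow, hs, hθ']⟩

variable {𝒱} in
/-- The function `x` on the overlap of the members `i` and `j` takes the values of the cocycle
`d`. -/
def HasCocycleValues (d : Cocycle (Multiplicative (ZMod p)) 𝒱.toEtaleCover) {i j : 𝒱.ι}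
    (x : 𝒱.B i ⊗[A] 𝒱.B j) : Prop :=
  ∀ {T : Over (Spec (.of A))} (g : T ⟶ overSpec A (𝒱.B i ⊗[A] 𝒱.B j)),
    HasValues (pullFn (R := .of (𝒱.B i ⊗[A] 𝒱.B j)) g.left x) fun t ↦
      (d.val (i := i) (j := j) (g ≫ overSpecMap Algebra.TensorProduct.includeLeft)
        (g ≫ overSpecMap Algebra.TensorProduct.includeRight) t).toAdd

lemma exists_hasCocycleValues (hA : (p : A) = 0)
    (d : Cocycle (Multiplicative (ZMod p)) 𝒱.toEtaleCover) (i j : 𝒱.ι) :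
    ∃ x : 𝒱.B i ⊗[A] 𝒱.B j, x ^ p = x ∧ HasCocycleValues d x := by
  have hB : (p : 𝒱.B i ⊗[A] 𝒱.B j) = 0 := cast_eq_zero_of_ringHom (algebraMap A _) hA
  let φ : LocallyConstant (Spec (.of (𝒱.B i ⊗[A] 𝒱.B j))) (ZMod p) :=
    ⟨_, (d.isLocallyConstant_val (i := i) (j := j)
      (overSpecMap Algebra.TensorProduct.includeLeft)
      (overSpecMap Algebra.TensorProduct.includeRight)).comp Multiplicative.toAdd⟩
  obtain ⟨x, hx, hxφ⟩ := exists_hasValues_pullFn_id (R := .of _) hB φ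
  refine ⟨x, hx, fun {T} g ↦ ?_⟩
  have hg := hxφ.comp g.left
  rw [appTop_pullFn_id] at hg
  simp only [d.val_precomp]
  exact hg

variable {𝒱} in
lemma HasCocycleValues.one_tmul_eq_sub (hA : (p : A) = 0)
    {d : Cocycle (Multiplicative (ZMod p)) 𝒱.toEtaleCover} {x : ∀ i j, 𝒱.B i ⊗[A] 𝒱.B j}
    (hx : ∀ i j, x i j ^ p = x i j) (hxd : ∀ i j, HasCocycleValues d (x i j)) (l i j : 𝒱.ι) :
    (1 : 𝒱.B l) ⊗ₜ[A] x i j =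
      Algebra.TensorProduct.map (.id A (𝒱.B l))
        (Algebra.TensorProduct.includeRight : 𝒱.B j →ₐ[A] 𝒱.B i ⊗[A] 𝒱.B j) (x l j) -
      Algebra.TensorProduct.map (.id A (𝒱.B l))
        (Algebra.TensorProduct.includeLeft : 𝒱.B i →ₐ[A] 𝒱.B i ⊗[A] 𝒱.B j) (x l i) := by
  let R : CommRingCat.{u} := .of (𝒱.B l ⊗[A] (𝒱.B i ⊗[A] 𝒱.B j))
  let ρ : 𝒱.B i ⊗[A] 𝒱.B j →ₐ[A] 𝒱.B l ⊗[A] (𝒱.B i ⊗[A] 𝒱.B j) :=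
    Algebra.TensorProduct.includeRight
  let ρ₁ : 𝒱.B l ⊗[A] 𝒱.B j →ₐ[A] 𝒱.B l ⊗[A] (𝒱.B i ⊗[A] 𝒱.B j) :=
    Algebra.TensorProduct.map (.id A (𝒱.B l)) Algebra.TensorProduct.includeRight
  let ρ₂ : 𝒱.B l ⊗[A] 𝒱.B i →ₐ[A] 𝒱.B l ⊗[A] (𝒱.B i ⊗[A] 𝒱.B j) :=
    Algebra.TensorProduct.map (.id A (𝒱.B l)) Algebra.TensorProduct.includeLeft
  change ρ (x i j) = ρ₁ (x l j) - ρ₂ (x l i)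
  have hl : ρ₂.comp Algebra.TensorProduct.includeLeft =
      ρ₁.comp Algebra.TensorProduct.includeLeft := by ext; simp [ρ₁, ρ₂]
  have hi : ρ₂.comp Algebra.TensorProduct.includeRight =
      ρ.comp Algebra.TensorProduct.includeLeft := by ext; simp [ρ, ρ₂]
  have hj : ρ₁.comp Algebra.TensorProduct.includeRight =
      ρ.comp Algebra.TensorProduct.includeRight := by ext; simp [ρ, ρ₁]
  have hR : (p : R) = 0 := cast_eq_zero_of_ringHom (algebraMap A R) hA
  have hT := cast_eq_zero_of_ringHom (pullFn (𝟙 (Spec R))) hR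
  have h := hxd i j (overSpecMap ρ)
  have h₁ := hxd l j (overSpecMap ρ₁)
  have h₂ := hxd l i (overSpecMap ρ₂)
  simp only [overSpecMap_comp] at h h₁ h₂
  rw [hl, hi] at h₂
  rw [hj] at h₁
  rw [pullFn_overSpecMap] at h h₁ h₂
  have hsub := h₁.sub hT h₂
  rw [← map_sub] at hsub
  refine pullFn_id_bijective.injective (h.eq hT ?_ ?_ ?_)
  · rw [← map_pow, ← map_pow, hx]
  · rw [← map_pow, sub_pow_of_cast_eq_zero hR, ← map_pow, ← map_pow, hx, hx]
  · convert hsub using 1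
    funext t
    rw [← d.val_trans (i := l) (j := i) (l := j) _ (overSpecMap (ρ.comp _)) _ t, toAdd_mul,
      add_sub_cancel_left]

lemma exists_represents (hA : (p : A) = 0)
    (d : Cocycle (Multiplicative (ZMod p)) 𝒱.toEtaleCover) :
    ∃ θ c, Represents d θ ∧ ∀ i, θ i ^ p - θ i = (𝒱.toEtaleCover.f i).appTop c := by
  have hS : (p : Γ(Spec (.of A), ⊤)) = 0 := cast_eq_zero_of_ringHom (pullFn (R := .of A) (𝟙 _)) hA
  choose x hx hxd using 𝒱.exists_hasCocycleValues hA d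
  obtain ⟨b, hb⟩ := exists_sub_eq_of_cocycle 𝒱.exists_comap_eq x
    (HasCocycleValues.one_tmul_eq_sub hA hx hxd)
  let θ (i) : Γ(𝒱.toEtaleCover.X i, ⊤) := pullFn (R := .of (𝒱.B i)) (𝟙 _) (b i)
  have hθ {i j : 𝒱.ι} {T : Over (Spec (.of A))} (g : T ⟶ overSpec A (𝒱.B i ⊗[A] 𝒱.B j)) :
      pullSection (g ≫ overSpecMap Algebra.TensorProduct.includeLeft) (θ i) -
        pullSection (g ≫ overSpecMap Algebra.TensorProduct.includeRight) (θ j) =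
      pullFn (R := .of (𝒱.B i ⊗[A] 𝒱.B j)) g.left (x i j) := by
    rw [pullSection_pullFn_id, pullSection_pullFn_id, pullFn_comp_overSpecMap,
      pullFn_comp_overSpecMap, ← map_sub, hb]
    rfl
  have hθd : Represents d θ := fun i j T a b ↦ by
    obtain ⟨g, rfl, rfl⟩ := exists_hom_overSpec_tensorProduct a b
    exact hθ g ▸ hxd i j g
  obtain ⟨c, hc⟩ := 𝒱.exists_appTop_eq (fun i ↦ θ i ^ p - θ i) fun i j T a b ↦ by
    obtain ⟨g, rfl, rfl⟩ := exists_hom_overSpec_tensorProduct a b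
    rw [map_sub, map_sub, map_pow, map_pow, ← sub_eq_sub_iff_sub_eq_sub,
      ← sub_pow_of_cast_eq_zero (cast_left_eq_zero hS T), hθ, ← map_pow, hx]
  exact ⟨θ, c, hθd, fun i ↦ (hc i).symm⟩

end AffineCover

/-! ### Artin–Schreier theory for affine schemes -/

section Div

variable {S : Scheme.{u}} {𝒰 : EtaleCover S} {C : Type w} [CommGroup C]

/-- The quotient of two cocycles with values in a commutative group. -/
def Cocycle.div (γ δ : Cocycle C 𝒰) : Cocycle C 𝒰 :=
  .ofVal (fun _ _ _ a b t ↦ γ.val a b t / δ.val a b t)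
    (fun _ _ _ a b ↦ (γ.isLocallyConstant_val a b).div (δ.isLocallyConstant_val a b))
    (fun _ _ _ _ φ a b t ↦ by rw [γ.val_precomp, δ.val_precomp])
    (fun _ _ _ _ a b c t ↦ by rw [div_mul_div_comm, γ.val_trans, δ.val_trans])

lemma Cocycle.isCohomologous_iff_div (γ δ : Cocycle C 𝒰) :
    γ.IsCohomologous δ ↔ (1 : Cocycle C 𝒰).IsCohomologous (δ.div γ) := by
  rw [Cocycle.isCohomologous_iff, Cocycle.isCohomologous_iff]
  refine exists_congr fun σ ↦ forall₂_congr fun i j ↦ forall₃_congr fun T a b ↦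
    forall_congr' fun t ↦ ?_
  change _ ↔ σ i (a.left t) * 1 = δ.val a b t / γ.val a b t * σ j (b.left t)
  rw [mul_one, div_mul_eq_mul_div, eq_div_iff_mul_eq']

lemma CoverMap.pullbackCocycle_div {S' : Scheme.{u}} {f : S' ⟶ S} {𝒲 : EtaleCover S'}
    (m : CoverMap f 𝒲 𝒰) (γ δ : Cocycle C 𝒰) :
    (m.pullbackCocycle γ).div (m.pullbackCocycle δ) = m.pullbackCocycle (γ.div δ) :=
  rfl

end Div

section ArtinSchreier

variable {p : ℕ} [Fact p.Prime] {A : Type u} [CommRing A]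

theorem exists_artinSchreier_eq_of_injective_pullback (hA : (p : A) = 0) {S' : Scheme.{u}}
    {f : S' ⟶ Spec (.of A)}
    (hf : Function.Injective (H1.pullback f (Multiplicative (ZMod p))))
    {c : Γ(Spec (.of A), ⊤)} {h : Γ(S', ⊤)} (hc : h ^ p - h = f.appTop c) :
    ∃ s, s ^ p - s = c := by
  have hS : (p : Γ(Spec (.of A), ⊤)) = 0 := cast_eq_zero_of_ringHom (pullFn (R := .of A) (𝟙 _)) hA
  have hS' : (p : Γ(S', ⊤)) = 0 := cast_eq_zero_of_ringHom f.appTop.hom hS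
  obtain ⟨a, rfl⟩ := pullFn_id_bijective.surjective c
  let 𝒰 := (asCover hA a).toEtaleCover
  let B : CommRingCat.{u} := .of (AdjoinRoot (asPoly p a))
  let θ (i) : Γ(𝒰.X i, ⊤) := pullFn (R := B) (𝟙 _) (AdjoinRoot.root (asPoly p a))
  have hθ (i) : θ i ^ p - θ i = (𝒰.f i).appTop (pullFn (𝟙 _) a) := by
    change pullFn (R := B) (𝟙 _) _ ^ p - pullFn (R := B) (𝟙 _) _ = _
    rw [← map_pow, ← map_sub, root_asPoly_pow_sub, appTop_pullFn_id]
    exact (pullFn_specMap (R := .of A) (R' := B) _ a).symm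
  obtain ⟨d, hd⟩ := exists_represents hS hθ
  let m := CoverMap.ofPullback f 𝒰
  have hm : (1 : Cocycle (Multiplicative (ZMod p)) _).IsCohomologous (m.pullbackCocycle d) := by
    refine ((hd.pullback m).sub_const h).isCohomologous_one hS' fun i ↦ ?_
    have hX := cast_eq_zero_of_ringHom ((pullbackCover f 𝒰).f i).appTop.hom hS'
    rw [sub_pow_of_cast_eq_zero hX, sub_eq_sub_iff_sub_eq_sub, m.artinSchreier_appTop_hom hθ,
      ← map_pow, ← map_sub, hc]
  obtain ⟨𝒱, n, hn⟩ := H1.pullback_injective_iff.mp hf 𝒰 _ m 1 d hm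
  obtain ⟨𝒱', ⟨n'⟩⟩ := 𝒱.exists_affine_refinement
  refine 𝒱'.exists_artinSchreier_eq hA ((hd.pullback n).pullback n')
    (n'.isCohomologous_pullback hn) fun i ↦ ?_
  exact n'.artinSchreier_appTop_hom (n.artinSchreier_appTop_hom hθ) i

theorem injective_pullback_of_artinSchreier (hA : (p : A) = 0) {L : Type u} [CommRing L]
    {f : Spec (.of L) ⟶ Spec (.of A)}
    (hf : ∀ (c : Γ(Spec (.of A), ⊤)) (h : Γ(Spec (.of L), ⊤)),
      h ^ p - h = f.appTop c → ∃ s, s ^ p - s = c) :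
    Function.Injective (H1.pullback f (Multiplicative (ZMod p))) := by
  have hS : (p : Γ(Spec (.of A), ⊤)) = 0 := cast_eq_zero_of_ringHom (pullFn (R := .of A) (𝟙 _)) hA
  have hL : (p : L) = 0 :=
    cast_eq_zero_of_ringHom (f.appTop ≫ (Scheme.ΓSpecIso (.of L)).hom).hom hS
  refine H1.pullback_injective_iff.mpr fun 𝒰 𝒲 m γ δ hγδ ↦ ?_
  rw [Cocycle.isCohomologous_iff_div, CoverMap.pullbackCocycle_div] at hγδ
  obtain ⟨𝒱, ⟨n⟩⟩ := 𝒰.exists_affine_refinement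
  refine ⟨𝒱.toEtaleCover, n, ?_⟩
  rw [Cocycle.isCohomologous_iff_div, CoverMap.pullbackCocycle_div]
  obtain ⟨θ, c, hd, hθ⟩ := 𝒱.exists_represents hA (n.pullbackCocycle (δ.div γ))
  obtain ⟨𝒲', r, m', hm'⟩ := m.exists_lift n
  obtain ⟨𝒲'', ⟨r'⟩⟩ := 𝒲'.exists_affine_refinement
  have hone := r'.isCohomologous_pullback
    (Cocycle.isCohomologous_trans (r.isCohomologous_pullback hγδ) (hm' (δ.div γ)))
  obtain ⟨h, hh⟩ := 𝒲''.exists_artinSchreier_eq hL ((hd.pullback m').pullback r') hone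
    fun i ↦ r'.artinSchreier_appTop_hom (m'.artinSchreier_appTop_hom hθ) i
  obtain ⟨s, hs⟩ := hf c h hh
  refine (hd.sub_const s).isCohomologous_one hS fun i ↦ ?_
  rw [sub_pow_of_cast_eq_zero (cast_eq_zero_of_ringHom (𝒱.toEtaleCover.f i).appTop.hom hS),
    sub_eq_sub_iff_sub_eq_sub, hθ, ← map_pow, ← map_sub, hs]

end ArtinSchreier

section Transport

variable {S₁ S₂ S₃ : Scheme.{u}} {G : Type w} [Group G]

lemma H1.pullback_comp (f : S₁ ⟶ S₂) (g : S₂ ⟶ S₃) :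
    H1.pullback (f ≫ g) G = H1.pullback f G ∘ H1.pullback g G := by
  funext x
  induction x using Quotient.inductionOn with | _ x
  obtain ⟨𝒰, γ⟩ := x
  change H1.pullback (f ≫ g) G (H1.mk 𝒰 γ) = H1.pullback f G (H1.pullback g G (H1.mk 𝒰 γ))
  let m := CoverMap.ofPullback g 𝒰
  let n := CoverMap.ofPullback f (pullbackCover g 𝒰)
  rw [H1.pullback_mk (n.comp m), H1.pullback_mk m, H1.pullback_mk n,
    CoverMap.pullbackCocycle_comp]

lemma H1.pullback_id : H1.pullback (𝟙 S₁) G = id := by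
  funext x
  induction x using Quotient.inductionOn with | _ x
  obtain ⟨𝒰, γ⟩ := x
  change H1.pullback (𝟙 S₁) G (H1.mk 𝒰 γ) = H1.mk 𝒰 γ
  rw [H1.pullback_mk (CoverMap.refl 𝒰), CoverMap.refl_pullbackCocycle]

lemma H1.bijective_pullback (f : S₁ ⟶ S₂) [IsIso f] : Function.Bijective (H1.pullback f G) := by
  refine Function.bijective_iff_has_inverse.mpr ⟨H1.pullback (inv f) G, fun x ↦ ?_, fun x ↦ ?_⟩
  · rw [← Function.comp_apply (f := H1.pullback (inv f) G), ← H1.pullback_comp, IsIso.inv_hom_id,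
      H1.pullback_id, id]
  · rw [← Function.comp_apply (f := H1.pullback f G), ← H1.pullback_comp, IsIso.hom_inv_id,
      H1.pullback_id, id]

end Transport

theorem injective_pullback_zmod_iff {p : ℕ} [Fact p.Prime] {S : Scheme.{u}} [IsAffine S]
    (hS : (p : Γ(S, ⊤)) = 0) {L : Type u} [CommRing L] (f : Spec (.of L) ⟶ S) :
    Function.Injective (H1.pullback f (Multiplicative (ZMod p))) ↔
      ∀ (c : Γ(S, ⊤)) (h : Γ(Spec (.of L), ⊤)), h ^ p - h = f.appTop c → ∃ s, s ^ p - s = c := by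
  let g : Spec (.of L) ⟶ Spec Γ(S, ⊤) := f ≫ S.isoSpec.hom
  let κ : Γ(Spec Γ(S, ⊤), ⊤) →+* Γ(S, ⊤) := S.isoSpec.hom.appTop.hom
  have hκ : Function.Bijective κ :=
    ConcreteCategory.bijective_of_isIso (S.isoSpec.hom.app ⊤)
  have hg (c) : g.appTop c = f.appTop (κ c) := by
    simp only [g, κ, Scheme.Hom.comp_appTop]
    rfl
  have hfg : Function.Injective (H1.pullback f (Multiplicative (ZMod p))) ↔
      Function.Injective (H1.pullback g (Multiplicative (ZMod p))) := by
    rw [H1.pullback_comp]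
    exact (Function.Injective.of_comp_iff' _ (H1.bijective_pullback _)).symm
  rw [hfg]
  refine ⟨fun H c h hc ↦ ?_, fun H ↦ injective_pullback_of_artinSchreier hS fun c h hc ↦ ?_⟩
  · obtain ⟨c, rfl⟩ := hκ.surjective c
    obtain ⟨s, rfl⟩ := exists_artinSchreier_eq_of_injective_pullback hS H (hc.trans (hg c).symm)
    exact ⟨κ s, by rw [map_sub, map_pow]⟩
  · obtain ⟨s, hs⟩ := H (κ c) h (hc.trans (hg c))
    obtain ⟨s, rfl⟩ := hκ.surjective s
    exact ⟨s, hκ.injective (by rw [map_sub, map_pow, hs])⟩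

lemma range_artinSchreier_inter_range_eq_iff {p : ℕ} {A L : Type*} [CommRing A] [CommRing L]
    {φ : A →+* L} (hφ : Function.Injective φ) :
    Set.range (artinSchreier p : L → L) ∩ Set.range φ = φ '' Set.range (artinSchreier p) ↔
      ∀ (c : A) (h : L), h ^ p - h = φ c → ∃ s, s ^ p - s = c := by
  have hsub : φ '' Set.range (artinSchreier p) ⊆ Set.range (artinSchreier p) ∩ Set.range φ := by
    rintro _ ⟨_, ⟨s, rfl⟩, rfl⟩
    exact ⟨⟨φ s, by rw [artinSchreier, artinSchreier, map_sub, map_pow]⟩, _, rfl⟩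
  rw [← hsub.ge_iff_eq']
  constructor
  · intro H c h hc
    obtain ⟨_, ⟨s, rfl⟩, hs⟩ := H ⟨⟨h, hc⟩, c, rfl⟩
    exact ⟨s, hφ hs⟩
  · rintro H _ ⟨⟨h, hc⟩, c, rfl⟩
    obtain ⟨s, hs⟩ := H c h hc
    exact ⟨c, ⟨s, hs⟩, rfl⟩

/-! ### The formal punctured neighbourhood of a point of a curve -/

section Restriction

variable {k : Type u} [Field k] {Y : Scheme.{u}} {π : Y ⟶ Spec (.of k)} {y : Spec (.of k) ⟶ Y}
  [IsLocallyNoetherian Y]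

lemma FormalCoordinate.expand_injective (e : FormalCoordinate π y) :
    Function.Injective e.expand := by
  have hcompletion : Function.Injective (algebraMap (localRing y) (completedLocalRing y)) :=
    AdicCompletion.of_injective _ (localRing y)
  exact (IsFractionRing.injective k⟦X⟧ k⸨X⸩).comp (e.equiv.injective.comp hcompletion)

variable [IsIntegral Y]

lemma FormalCoordinate.toCurve_apply (e : FormalCoordinate π y) (x : Spec (.of k⸨X⸩)) :
    e.toCurve x = genericPoint Y := by
  obtain ⟨q, hq⟩ : genericPoint Y ∈ Set.range (Y.fromSpecStalk (point y)) := by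
    rw [Scheme.range_fromSpecStalk]
    exact genericPoint_specializes _
  have hx : Spec.map (CommRingCat.ofHom e.expand) x ⤳ q := by
    refine (PrimeSpectrum.le_iff_specializes _ _).mp fun a (ha : e.expand a ∈ x.asIdeal) ↦ ?_
    rw [(eq_bot_or_eq_top x.asIdeal).resolve_right x.isPrime.ne_top, Ideal.mem_bot] at ha
    rw [(map_eq_zero_iff _ e.expand_injective).mp ha]
    exact zero_mem _
  have h := hx.map (Y.fromSpecStalk (point y)).continuous
  rw [hq] at h
  exact (h.antisymm (genericPoint_specializes _)).eq

lemma FormalCoordinate.restrict_injective [IsSeparated π] (e : FormalCoordinate π y)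
    (hy : y ≫ π = 𝟙 _) : Function.Injective (e.restrict hy) := by
  let g : Spec (.of k⸨X⸩) ⟶ complement π y hy := e.toComplement hy
  let x : Spec (.of k⸨X⸩) := IsLocalRing.closedPoint k⸨X⸩
  have : Nonempty (complement π y hy) := ⟨g x⟩
  have : IsIntegral (complement π y hy : Scheme) :=
    isIntegral_of_isOpenImmersion (complement π y hy).ι
  have hgx : g x = genericPoint (complement π y hy : Scheme) := by
    refine (complement π y hy).ι.isOpenEmbedding.injective ?_
    rw [genericPoint_eq_of_isOpenImmersion, ← e.toCurve_apply x, ← Scheme.Hom.comp_apply]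
    exact congrArg (fun φ : Spec (.of k⸨X⸩) ⟶ Y ↦ φ x) (IsOpenImmersion.lift_fac _ _ _)
  refine (injective_iff_map_eq_zero _).mpr fun f hf ↦ ?_
  have hgf : g.appTop f = 0 :=
    (map_eq_zero_iff _ (Scheme.ΓSpecIso (.of k⸨X⸩)).commRingCatIsoToRingEquiv.injective).mp hf
  refine (basicOpen_eq_bot_iff f).mp (bot_unique fun z hz ↦ ?_)
  have hη : x ∈ g ⁻¹ᵁ Scheme.basicOpen _ f := by
    rw [Scheme.Hom.mem_preimage, hgx]
    exact (genericPoint_specializes z).mem_open (Scheme.basicOpen _ f).isOpen hz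
  rwa [Scheme.preimage_basicOpen_top, hgf, Scheme.basicOpen_zero] at hη

end Restriction

end LocalGlobal

open LocalGlobal in
theorem theorem1p4_general {p : ℕ} [Fact p.Prime] {S : Scheme.{u}} [IsAffine S] {L : Type u}
    [CommRing L] [CharP L p] [ConnectedSpace (PrimeSpectrum L)] (f : Spec (.of L) ⟶ S)
    (hf : Function.Injective (f.appTop ≫ (Scheme.ΓSpecIso (.of L)).hom).hom)
    (G : Type w) [Group G] [Finite G] [Nontrivial G] (hG : IsPGroup p G) :
    List.TFAE
      [Set.range (artinSchreier p : L → L) ∩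
            Set.range (f.appTop ≫ (Scheme.ΓSpecIso (.of L)).hom).hom =
          (f.appTop ≫ (Scheme.ΓSpecIso (.of L)).hom).hom '' Set.range (artinSchreier p),
        Function.Injective (H1.pullback f G),
        Function.Injective (H1.pullback f (Multiplicative (ZMod p)))] := by
  let ε : Γ(Spec (.of L), ⊤) ≃+* L := (Scheme.ΓSpecIso (.of L)).commRingCatIsoToRingEquiv
  have hS : (p : Γ(S, ⊤)) = 0 := hf (by rw [map_natCast, map_zero, CharP.cast_eq_zero])
  have : ConnectedSpace (Spec (.of L)) := inferInstanceAs (ConnectedSpace (PrimeSpectrum L))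
  tfae_have 3 → 2 := fun h ↦ injective_pullback_of_isPGroup h hG
  tfae_have 2 → 3 := injective_pullback_zmod_of_isPGroup hG
  tfae_have 1 ↔ 3 := by
    rw [injective_pullback_zmod_iff hS, range_artinSchreier_inter_range_eq_iff hf]
    refine forall_congr' fun c ↦ ε.surjective.forall.trans <| forall_congr' fun h ↦
      imp_congr_left ?_
    rw [← map_pow, ← map_sub]
    exact ε.injective.eq_iff
  tfae_finish

theorem theorem1p4 {p : ℕ} [Fact p.Prime] {k : Type u} [Field k] [CharP k p]
    {Y : Scheme.{u}} (π : Y ⟶ Spec (.of k))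
    [IsIntegral Y] [IsProper π] [SmoothOfRelativeDimension 1 π]
    (y : Spec (.of k) ⟶ Y) (hy : y ≫ π = 𝟙 (Spec (.of k)))
    (e : LocalGlobal.FormalCoordinate π y)
    (G : Type w) [Group G] [Finite G] [Nontrivial G] (hG : IsPGroup p G) :
    List.TFAE
      [Set.range (LocalGlobal.artinSchreier p : k⸨X⸩ → k⸨X⸩) ∩ Set.range (e.restrict hy) =
          e.restrict hy '' Set.range (LocalGlobal.artinSchreier p),
        Function.Injective (e.Psi hy G),
        Function.Injective (e.Psi hy (Multiplicative (ZMod p)))] := by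
  have : IsLocallyNoetherian Y := LocallyOfFiniteType.isLocallyNoetherian π
  have : IsAffine (LocalGlobal.complement π y hy) := LocalGlobal.isAffine_complement e hy
  have : CharP k⸨X⸩ p := charP_of_injective_ringHom (HahnSeries.C : k →+* k⸨X⸩).injective p
  exact theorem1p4_general (e.toComplement hy) (e.restrict_injective hy) G hG
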